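/- **Notation.** Let $\mathbb H$ be the upper half plane, $T=\begin{pmatrix}1&1\\0&1\end{pmatrix}$, $V=\begin{pmatrix}1&0\\1&1\end{pmatrix}$. A *weakly holomorphic modular function* for $\mathrm{SL}(2,\mathbb Z)$ is a holomorphic function $f:\mathbb H\to\mathbb C$ that is invariant under $\mathrm{SL}(2,\mathbb Z)$ and meromorphic at the cusp $i\infty$. For a hyperbolic matrix $A\in\mathrm{SL}(2,\mathbb Z)$ (i.e. $|\mathrm{tr}\,A|>2$) with repelling fixed point $w$ and attracting fixed point $\tilde w$, let $Q(x,y)=ax^2+bxy+cy^2$ be the primitive integral quadratic form with $Q(w,1)=Q(\tilde w,1)=0$ and $\mathrm{sgn}(a)=\mathrm{sgn}(w-\tilde w)$, let $D=b^2-4ac>0$, and put $$I_f(A)=\int_{\tau_0}^{A\tau_0}\frac{f(\tau)\sqrt D}{Q(\tau,1)}\,d\tau ,$$ which does not depend on $\tau_0\in\mathbb H$. Put $I_f(A)=0$ if $A$ is not hyperbolic. For a real number $x>0$ let $(A_n)_{n\ge 0}$ be the unique sequence in $\mathrm{SL}(2,\mathbb Z)$ such that $A_0=I$, $A_n^{-1}A_{n+1}\in\{T,V\}$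 for all $n\ge 0$, $A_n^{-1}A_{n+1}=V$ for infinitely many $n$, and $A_n(1)\to x$ as $n\to\infty$, where $A(1)=\frac{a+b}{c+d}$ for $A=\begin{pmatrix}a&b\\c&d\end{pmatrix}$. (The numbers $A_n(1)$ are the Farey fractions on a path down the Farey tree from $\frac11$ that converges to $x$.) Define $$\Lambda_f(x)=\limsup_{n\to\infty}\frac{\mathrm{Re}(I_f(A_n))}{n}\in[-\infty,\infty].$$ **Theorem 1.1.** Let $f\not\equiv0$ be a weakly holomorphic modular function for $\mathrm{SL}(2,\mathbb Z)$ that is real and non-negative on the arc $\{e^{it}:\pi/3\le t\le 2\pi/3\}$. Then $\Lambda_f(x)$ is finite for every real $x>0$, and $\Lambda_f$ extends to a function $\Lambda_f:\mathbb P^1(\mathbb R)\to\mathbb R$ such that $$\Lambda_f\left(\frac{ax+b}{cx+d}\right)=\Lambda_f(x)\quad\text{for all }x\in\mathbb P^1(\mathbb R)\text{ and all }\begin{pmatrix}a&b\\c&d\end{pmatrix}\in\mathrm{GL}(2,\mathbb Z),$$ and $\Lambda_f(x)=0$ for all $x\in\mathbb P^1(\mathbb Q)$. -/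

import Mathlib

open scoped UpperHalfPlane MatrixGroups Manifold Topology

namespace FareyLyapunov

/-- A weakly holomorphic modular function for `SL(2, ℤ)`: holomorphic on the upper half plane,
invariant under `SL(2, ℤ)` and meromorphic at the cusp, that is, meromorphic at `q = 0` as a
function of `q = exp (2 π i τ)`. -/
structure IsWeaklyHolomorphicModularFunction (f : ℍ → ℂ) : Prop where
  holomorphic : MDifferentiable 𝓘(ℂ) 𝓘(ℂ) f
  invariant : ∀ (γ : SL(2, ℤ)) (τ : ℍ), f (γ • τ) = f τ
  meromorphic : MeromorphicAt (UpperHalfPlane.cuspFunction 1 f) 0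

/-! ### Cycle integrals -/

/-- `z` is a fixed point of the Möbius transformation of `A`. -/
def IsFixedPoint (A : SL(2, ℤ)) (z : ℝ) : Prop :=
  (A 1 0 : ℝ) * z + A 1 1 ≠ 0 ∧ ((A 0 0 : ℝ) * z + A 0 1) / ((A 1 0 : ℝ) * z + A 1 1) = z

/-- An attracting fixed point: the derivative `1 / (c z + d) ^ 2` has absolute value `< 1`. -/
def IsAttractingFixedPoint (A : SL(2, ℤ)) (z : ℝ) : Prop :=
  IsFixedPoint A z ∧ 1 / ((A 1 0 : ℝ) * z + A 1 1) ^ 2 < 1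

/-- A repelling fixed point: the derivative `1 / (c z + d) ^ 2` has absolute value `> 1`. -/
def IsRepellingFixedPoint (A : SL(2, ℤ)) (z : ℝ) : Prop :=
  IsFixedPoint A z ∧ 1 < 1 / ((A 1 0 : ℝ) * z + A 1 1) ^ 2

/-- The greatest common divisor of the coefficients of `c x ^ 2 + (d - a) x y - b y ^ 2`, where
`A = (a, b; c, d)`. -/
def content (A : SL(2, ℤ)) : ℕ :=
  Int.gcd (A 1 0) (Int.gcd (A 1 1 - A 0 0) (A 0 1))

/-- The coefficients `(a, b, c)` of the primitive integral quadratic form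
`Q = a x ^ 2 + b x y + c y ^ 2` attached to a hyperbolic `A`: it vanishes at the fixed points of
`A`, and `a` has the sign of `w - w'` with `w` the repelling and `w'` the attracting fixed point
(see `cycleForm_spec`). -/
def cycleForm (A : SL(2, ℤ)) : ℤ × ℤ × ℤ :=
  (-(A 0 0 + A 1 1).sign * (A 1 0 / content A),
   -(A 0 0 + A 1 1).sign * ((A 1 1 - A 0 0) / content A),
   (A 0 0 + A 1 1).sign * (A 0 1 / content A))

/-- The discriminant of the form `cycleForm A`. -/
def cycleDisc (A : SL(2, ℤ)) : ℤ :=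
  (cycleForm A).2.1 ^ 2 - 4 * (cycleForm A).1 * (cycleForm A).2.2

/-- `Q(z, 1)` for the form `Q = cycleForm A`. -/
def cycleQuad (A : SL(2, ℤ)) (z : ℂ) : ℂ :=
  (cycleForm A).1 * z ^ 2 + (cycleForm A).2.1 * z + (cycleForm A).2.2

/-- The integrand `f(z) √D / Q(z, 1)`. -/
noncomputable def cycleIntegrand (f : ℍ → ℂ) (A : SL(2, ℤ)) (z : ℂ) : ℂ :=
  f (UpperHalfPlane.ofComplex z) * (Real.sqrt (cycleDisc A) : ℂ) / cycleQuad A z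

/-- The integral of `f(z) √D / Q(z, 1) dz` along the segment from `τ₀` to `A τ₀`. -/
noncomputable def cycleIntegralFrom (f : ℍ → ℂ) (A : SL(2, ℤ)) (τ₀ : ℍ) : ℂ :=
  ∫ s in (0 : ℝ)..1,
    cycleIntegrand f A ((τ₀ : ℂ) + s * (((A • τ₀ : ℍ) : ℂ) - τ₀)) * (((A • τ₀ : ℍ) : ℂ) - τ₀)

open Classical in
/-- The cycle integral `I_f(A)`, computed from the base point `i`; it is `0` if `A` is not
hyperbolic. It does not depend on the base point, see `cycleIntegral_eq_cycleIntegralFrom`. -/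
noncomputable def cycleIntegral (f : ℍ → ℂ) (A : SL(2, ℤ)) : ℂ :=
  if (A : Matrix (Fin 2) (Fin 2) ℤ).IsHyperbolic then cycleIntegralFrom f A UpperHalfPlane.I else 0

/-! ### Paths in the Farey tree -/

/-- `T = (1, 1; 0, 1)`. -/
def matT : SL(2, ℤ) := ⟨!![1, 1; 0, 1], by simp [Matrix.det_fin_two]⟩

/-- `V = (1, 0; 1, 1)`. -/
def matV : SL(2, ℤ) := ⟨!![1, 0; 1, 1], by simp [Matrix.det_fin_two]⟩

/-- The Farey fraction `A(1) = (a + b) / (c + d)` to which `A = (a, b; c, d)` is associated. -/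
def fareyFraction (A : SL(2, ℤ)) : ℚ :=
  ((A 0 0 + A 0 1 : ℤ) : ℚ) / ((A 1 0 + A 1 1 : ℤ) : ℚ)

/-- `A` is the sequence of matrices associated to the infinite path in the Farey tree that starts
at `1 / 1` and converges to `x`: each step goes down to one of the two children of the current
Farey fraction, namely to the smaller one by `V` and to the larger one by `T`. The last field
selects one of the two paths that converge to a given rational number. -/
structure IsFareyPath (x : ℝ) (A : ℕ → SL(2, ℤ)) : Prop where
  start : A 0 = 1
  step : ∀ n, A (n + 1) = A n * matV ∨ A (n + 1) = A n * matT
  tendsto : Filter.Tendsto (fun n => (fareyFraction (A n) : ℝ)) Filter.atTop (𝓝 x)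
  frequently : ∃ᶠ n in Filter.atTop, A (n + 1) = A n * matV

open Classical in
/-- The sequence of matrices associated to `x > 0`: move to the smaller child (`V`) if `x` lies to
the left of the current Farey fraction, and to the larger child (`T`) otherwise. By
`isFareyPath_iff` this is the only sequence that satisfies `IsFareyPath x`. -/
noncomputable def fareyPath (x : ℝ) : ℕ → SL(2, ℤ)
  | 0 => 1
  | n + 1 => if x < fareyFraction (fareyPath x n) then fareyPath x n * matV
      else fareyPath x n * matT

/-- The limit superior of `Re I_f(A_n) / n` in the extended reals, for the sequence `A_n`
associated to `x > 0`. -/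
noncomputable def lyapunovExponent (f : ℍ → ℂ) (x : ℝ) : EReal :=
  Filter.limsup (fun n : ℕ => (((cycleIntegral f (fareyPath x n)).re / n : ℝ) : EReal))
    Filter.atTop


theorem content_spec {A : SL(2, ℤ)} (h : (A : Matrix (Fin 2) (Fin 2) ℤ).IsHyperbolic) :
    A 1 0 ≠ 0 ∧ content A ≠ 0 ∧ 4 < (A 0 0 + A 1 1) ^ 2 := by
  have hdet : A 0 0 * A 1 1 - A 0 1 * A 1 0 = 1 := by
    have := A.det_coe
    rwa [Matrix.det_fin_two] at this
  have hd : 4 < (A 0 0 + A 1 1) ^ 2 := by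
    have h' : 0 < (A : Matrix (Fin 2) (Fin 2) ℤ).discr := h
    rw [Matrix.discr_fin_two, Matrix.trace_fin_two, Matrix.det_fin_two] at h'
    nlinarith
  have hc : A 1 0 ≠ 0 := by
    intro hc
    rw [hc, mul_zero, sub_zero] at hdet
    rcases Int.eq_one_or_neg_one_of_mul_eq_one' hdet with ⟨h1, h2⟩ | ⟨h1, h2⟩ <;>
      rw [h1, h2] at hd <;> norm_num at hd
  refine ⟨hc, ?_, hd⟩
  intro h0
  exact hc (Int.gcd_eq_zero_iff.mp h0).1

/-- The real form of `cycleForm A`, up to the factor `content A`. -/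
theorem cycleForm_mul_content (A : SL(2, ℤ)) :
    (cycleForm A).1 * content A = -(A 0 0 + A 1 1).sign * A 1 0 ∧
    (cycleForm A).2.1 * content A = -(A 0 0 + A 1 1).sign * (A 1 1 - A 0 0) ∧
    (cycleForm A).2.2 * content A = (A 0 0 + A 1 1).sign * A 0 1 := by
  have h1 : ((content A : ℕ) : ℤ) ∣ A 1 0 := Int.gcd_dvd_left ..
  have h2 : ((content A : ℕ) : ℤ) ∣ (Int.gcd (A 1 1 - A 0 0) (A 0 1) : ℕ) := Int.gcd_dvd_right ..
  have h3 : ((content A : ℕ) : ℤ) ∣ A 1 1 - A 0 0 := h2.trans (Int.gcd_dvd_left ..)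
  have h4 : ((content A : ℕ) : ℤ) ∣ A 0 1 := h2.trans (Int.gcd_dvd_right ..)
  refine ⟨?_, ?_, ?_⟩
  · simp only [cycleForm]; rw [mul_assoc, Int.ediv_mul_cancel h1]
  · simp only [cycleForm]; rw [mul_assoc, Int.ediv_mul_cancel h3]
  · simp only [cycleForm]; rw [mul_assoc, Int.ediv_mul_cancel h4]

theorem sign_sq_of_hyperbolic {A : SL(2, ℤ)}
    (h : (A : Matrix (Fin 2) (Fin 2) ℤ).IsHyperbolic) : (A 0 0 + A 1 1).sign ^ 2 = 1 := by
  obtain ⟨-, -, h3⟩ := content_spec h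
  have h0 : A 0 0 + A 1 1 ≠ 0 := by intro h0; rw [h0] at h3; norm_num at h3
  rcases lt_or_gt_of_ne h0 with h | h
  · rw [Int.sign_eq_neg_one_of_neg h]; norm_num
  · rw [Int.sign_eq_one_of_pos h]; norm_num

theorem cycleDisc_mul {A : SL(2, ℤ)} (h : (A : Matrix (Fin 2) (Fin 2) ℤ).IsHyperbolic) :
    cycleDisc A * (content A : ℤ) ^ 2 = (A 0 0 + A 1 1) ^ 2 - 4 := by
  have hdet : A 0 0 * A 1 1 - A 0 1 * A 1 0 = 1 := by
    have := A.det_coe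
    rwa [Matrix.det_fin_two] at this
  obtain ⟨h1, h2, h3⟩ := cycleForm_mul_content A
  have hs := sign_sq_of_hyperbolic h
  have : cycleDisc A * (content A : ℤ) ^ 2 = ((cycleForm A).2.1 * content A) ^ 2
      - 4 * ((cycleForm A).1 * content A) * ((cycleForm A).2.2 * content A) := by
    rw [cycleDisc]; ring
  rw [this, h1, h2, h3]
  linear_combination ((A 1 1 - A 0 0) ^ 2 + 4 * A 0 1 * A 1 0) * hs - 4 * hdet

theorem cycleDisc_pos {A : SL(2, ℤ)} (h : (A : Matrix (Fin 2) (Fin 2) ℤ).IsHyperbolic) :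
    0 < cycleDisc A := by
  have h1 := cycleDisc_mul h
  obtain ⟨-, -, h3⟩ := content_spec h
  by_contra h4
  nlinarith [mul_nonneg (neg_nonneg.mpr (not_lt.mp h4)) (sq_nonneg (content A : ℤ))]

/-- The defining properties of `cycleForm A`: it is primitive, it is indefinite, its roots are the
repelling fixed point `w` and the attracting fixed point `w'` of `A`, and its leading coefficient
has the sign of `w - w'`. -/
theorem cycleForm_spec {A : SL(2, ℤ)} (h : (A : Matrix (Fin 2) (Fin 2) ℤ).IsHyperbolic) :
    Int.gcd (cycleForm A).1 (Int.gcd (cycleForm A).2.1 (cycleForm A).2.2) = 1 ∧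
    0 < cycleDisc A ∧
    ∃ w w' : ℝ, IsRepellingFixedPoint A w ∧ IsAttractingFixedPoint A w' ∧
      ((cycleForm A).1 : ℝ) * w ^ 2 + (cycleForm A).2.1 * w + (cycleForm A).2.2 = 0 ∧
      ((cycleForm A).1 : ℝ) * w' ^ 2 + (cycleForm A).2.1 * w' + (cycleForm A).2.2 = 0 ∧
      0 < ((cycleForm A).1 : ℝ) * (w - w') := by
  have hdet : A 0 0 * A 1 1 - A 0 1 * A 1 0 = 1 := by
    have := A.det_coe
    rwa [Matrix.det_fin_two] at this
  obtain ⟨hc, hg, ht⟩ := content_spec h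
  obtain ⟨h1, h2, h3⟩ := cycleForm_mul_content A
  have hs := sign_sq_of_hyperbolic h
  refine ⟨?_, cycleDisc_pos h, ?_⟩
  · -- a common divisor, times the content, divides the content
    set e := Int.gcd (cycleForm A).1 (Int.gcd (cycleForm A).2.1 (cycleForm A).2.2) with he
    have e1 : (e : ℤ) ∣ (cycleForm A).1 := Int.gcd_dvd_left ..
    have e0 : (e : ℤ) ∣ (Int.gcd (cycleForm A).2.1 (cycleForm A).2.2 : ℕ) :=
      Int.gcd_dvd_right ..
    have e2 : (e : ℤ) ∣ (cycleForm A).2.1 := e0.trans (Int.gcd_dvd_left ..)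
    have e3 : (e : ℤ) ∣ (cycleForm A).2.2 := e0.trans (Int.gcd_dvd_right ..)
    set s := (A 0 0 + A 1 1).sign
    have d1 : (e * content A : ℤ) ∣ A 1 0 := by
      have := (mul_dvd_mul_right e1 (content A : ℤ)).mul_left (-s)
      rwa [h1, show -s * (-s * A 1 0) = s ^ 2 * A 1 0 by ring, hs, one_mul] at this
    have d2 : (e * content A : ℤ) ∣ A 1 1 - A 0 0 := by
      have := (mul_dvd_mul_right e2 (content A : ℤ)).mul_left (-s)
      rwa [h2, show -s * (-s * (A 1 1 - A 0 0)) = s ^ 2 * (A 1 1 - A 0 0) by ring, hs,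
        one_mul] at this
    have d3 : (e * content A : ℤ) ∣ A 0 1 := by
      have := (mul_dvd_mul_right e3 (content A : ℤ)).mul_left s
      rwa [h3, show s * (s * A 0 1) = s ^ 2 * A 0 1 by ring, hs, one_mul] at this
    have d4 : (e * content A : ℤ) ∣ (content A : ℕ) :=
      Int.dvd_coe_gcd d1 (Int.dvd_coe_gcd d2 d3)
    have d5 : e * content A ∣ 1 * content A := by
      rw [one_mul]; exact_mod_cast d4
    exact Nat.dvd_one.mp (Nat.dvd_of_mul_dvd_mul_right (Nat.pos_of_ne_zero hg) d5)
  · have hdetR : (A 0 0 : ℝ) * A 1 1 - A 0 1 * A 1 0 = 1 := by exact_mod_cast hdet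
    have hcR : (A 1 0 : ℝ) ≠ 0 := by exact_mod_cast hc
    have hgR : (0 : ℝ) < (content A : ℝ) := by exact_mod_cast Nat.pos_of_ne_zero hg
    have htR : (4 : ℝ) < ((A 0 0 : ℝ) + A 1 1) ^ 2 := by exact_mod_cast ht
    have h1R : ((cycleForm A).1 : ℝ) * content A = -((A 0 0 + A 1 1).sign : ℤ) * A 1 0 := by
      exact_mod_cast h1
    have h2R : ((cycleForm A).2.1 : ℝ) * content A
        = -((A 0 0 + A 1 1).sign : ℤ) * (A 1 1 - A 0 0) := by exact_mod_cast h2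
    have h3R : ((cycleForm A).2.2 : ℝ) * content A = ((A 0 0 + A 1 1).sign : ℤ) * A 0 1 := by
      exact_mod_cast h3
    have hsR : (((A 0 0 + A 1 1).sign : ℤ) : ℝ) ^ 2 = 1 := by exact_mod_cast hs
    have habs : (((A 0 0 + A 1 1).sign : ℤ) : ℝ) * ((A 0 0 : ℝ) + A 1 1)
        = |(A 0 0 : ℝ) + A 1 1| := by
      have := Int.sign_mul_abs (A 0 0 + A 1 1)
      have h5 : ((A 0 0 + A 1 1).sign : ℤ) * (A 0 0 + A 1 1) = |A 0 0 + A 1 1| :=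
        Int.sign_mul_self_eq_abs _
      exact_mod_cast h5
    set s : ℝ := (((A 0 0 + A 1 1).sign : ℤ) : ℝ) with hsdef
    set α : ℝ := (A 0 0 : ℝ)
    set β : ℝ := (A 0 1 : ℝ)
    set γ : ℝ := (A 1 0 : ℝ)
    set δ : ℝ := (A 1 1 : ℝ)
    set r : ℝ := Real.sqrt ((α + δ) ^ 2 - 4) with hr
    have hr2 : r ^ 2 = (α + δ) ^ 2 - 4 := Real.sq_sqrt (by linarith)
    have hr0 : 0 < r := Real.sqrt_pos.mpr (by linarith)
    have hden : ∀ ε : ℝ, γ * ((α - δ + ε * s * r) / (2 * γ)) + δ = s * (|α + δ| + ε * r) / 2 := by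
      intro ε
      rw [← habs]
      field_simp
      linear_combination -(α + δ) * hsR
    have hprod : (|α + δ| + r) * (|α + δ| - r) = 4 := by
      have := sq_abs (α + δ)
      nlinarith
    have ha2 : 2 < |α + δ| := by
      have := sq_abs (α + δ)
      nlinarith [abs_nonneg (α + δ)]
    have hbig : 2 < |α + δ| + r := by linarith
    have hsmall0 : 0 < |α + δ| - r := by
      by_contra hh
      nlinarith
    have hsmall : |α + δ| - r < 2 := by
      nlinarith
    have hfix : ∀ ε : ℝ, ε ^ 2 = 1 → γ * ((α - δ + ε * s * r) / (2 * γ)) ^ 2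
        + (δ - α) * ((α - δ + ε * s * r) / (2 * γ)) - β = 0 := by
      intro ε hε
      field_simp
      linear_combination (r ^ 2 * s ^ 2) * hε + r ^ 2 * hsR + hr2 + 4 * hdetR
    have hfix' : ∀ z : ℝ, γ * z ^ 2 + (δ - α) * z - β = 0 → γ * z + δ ≠ 0 →
        IsFixedPoint A z := by
      intro z hz hz0
      refine ⟨hz0, ?_⟩
      rw [div_eq_iff hz0]
      linear_combination -hz
    have hroot : ∀ z : ℝ, γ * z ^ 2 + (δ - α) * z - β = 0 →
        ((cycleForm A).1 : ℝ) * z ^ 2 + (cycleForm A).2.1 * z + (cycleForm A).2.2 = 0 := by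
      intro z hz
      have : (((cycleForm A).1 : ℝ) * z ^ 2 + (cycleForm A).2.1 * z + (cycleForm A).2.2)
          * content A = 0 := by
        linear_combination z ^ 2 * h1R + z * h2R + h3R - s * hz
      exact (mul_eq_zero.mp this).resolve_right hgR.ne'
    have hs0 : s ≠ 0 := by intro h0; rw [h0] at hsR; norm_num at hsR
    have dw := hden (-1)
    have dw' := hden 1
    refine ⟨(α - δ + (-1) * s * r) / (2 * γ), (α - δ + 1 * s * r) / (2 * γ),
      ⟨hfix' _ (hfix _ (by norm_num)) ?_, ?_⟩, ⟨hfix' _ (hfix _ (by norm_num)) ?_, ?_⟩,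
      hroot _ (hfix _ (by norm_num)), hroot _ (hfix _ (by norm_num)), ?_⟩
    · rw [dw]
      have : |α + δ| + -1 * r ≠ 0 := by linarith
      positivity
    · change 1 < 1 / (γ * _ + δ) ^ 2
      rw [dw, lt_div_iff₀ (by
        have : |α + δ| + -1 * r ≠ 0 := by linarith
        positivity)]
      rw [div_pow, mul_pow, hsR]
      nlinarith
    · rw [dw']
      have : |α + δ| + 1 * r ≠ 0 := by linarith
      positivity
    · change 1 / (γ * _ + δ) ^ 2 < 1
      rw [dw', div_lt_iff₀ (by
        have : |α + δ| + 1 * r ≠ 0 := by linarith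
        positivity)]
      rw [div_pow, mul_pow, hsR]
      nlinarith
    · have h6 : ((cycleForm A).1 : ℝ) * ((α - δ + (-1) * s * r) / (2 * γ)
          - (α - δ + 1 * s * r) / (2 * γ)) * content A = r := by
        have : (α - δ + (-1) * s * r) / (2 * γ) - (α - δ + 1 * s * r) / (2 * γ)
            = - (s * r / γ) := by field_simp; ring
        rw [this, mul_right_comm, h1R]
        field_simp
        linear_combination hsR
      by_contra h7
      nlinarith

/-! ### Independence of the base point -/

theorem cycleQuad_ne_zero {A : SL(2, ℤ)} (h : (A : Matrix (Fin 2) (Fin 2) ℤ).IsHyperbolic)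
    {z : ℂ} (hz : 0 < z.im) : cycleQuad A z ≠ 0 := by
  obtain ⟨-, hD, w, w', -, -, hw, hw', ha⟩ := cycleForm_spec h
  set a : ℝ := ((cycleForm A).1 : ℝ)
  set b : ℝ := ((cycleForm A).2.1 : ℝ)
  set c : ℝ := ((cycleForm A).2.2 : ℝ)
  have ha0 : a ≠ 0 := by rintro h0; rw [h0] at ha; simp at ha
  have hww : w - w' ≠ 0 := by rintro h0; rw [h0] at ha; simp at ha
  have hb : b = -a * (w + w') := by
    have : (w - w') * (b + a * (w + w')) = 0 := by linear_combination hw - hw'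
    linarith [(mul_eq_zero.mp this).resolve_left hww]
  have hc : c = a * w * w' := by rw [hb] at hw; linear_combination hw
  have hq : cycleQuad A z = (a : ℂ) * (z - w) * (z - w') := by
    have : cycleQuad A z = (a : ℂ) * z ^ 2 + (b : ℂ) * z + (c : ℂ) := by
      simp [cycleQuad, a, b, c]
    rw [this, hb, hc]; push_cast; ring
  rw [hq]
  have h1 : ∀ x : ℝ, z - (x : ℂ) ≠ 0 := by
    intro x hx
    have := congrArg Complex.im hx
    simp at this
    exact hz.ne' this
  exact mul_ne_zero (mul_ne_zero (by exact_mod_cast ha0) (h1 w)) (h1 w')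

theorem cycleQuad_moebius (A : SL(2, ℤ)) {z : ℂ} (hz : (A 1 0 : ℂ) * z + A 1 1 ≠ 0) :
    cycleQuad A (((A 0 0 : ℂ) * z + A 0 1) / ((A 1 0 : ℂ) * z + A 1 1))
      * ((A 1 0 : ℂ) * z + A 1 1) ^ 2 * content A = cycleQuad A z * content A := by
  obtain ⟨h1, h2, h3⟩ := cycleForm_mul_content A
  have hdet : A 0 0 * A 1 1 - A 0 1 * A 1 0 = 1 := by
    have := A.det_coe
    rwa [Matrix.det_fin_two] at this
  have hdetC : (A 0 0 : ℂ) * A 1 1 - A 0 1 * A 1 0 = 1 := by exact_mod_cast hdet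
  have h1C : ((cycleForm A).1 : ℂ) * content A = -((A 0 0 + A 1 1).sign : ℤ) * A 1 0 := by
    exact_mod_cast h1
  have h2C : ((cycleForm A).2.1 : ℂ) * content A
      = -((A 0 0 + A 1 1).sign : ℤ) * (A 1 1 - A 0 0) := by exact_mod_cast h2
  have h3C : ((cycleForm A).2.2 : ℂ) * content A = ((A 0 0 + A 1 1).sign : ℤ) * A 0 1 := by
    exact_mod_cast h3
  have key : ∀ y : ℂ, cycleQuad A y * content A = -(((A 0 0 + A 1 1).sign : ℤ) : ℂ) *
      ((A 1 0 : ℂ) * y ^ 2 + (A 1 1 - A 0 0) * y - A 0 1) := by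
    intro y
    rw [cycleQuad]
    linear_combination y ^ 2 * h1C + y * h2C + h3C
  rw [mul_right_comm, key, key]
  set s : ℂ := (((A 0 0 + A 1 1).sign : ℤ) : ℂ)
  set n := (A 0 0 : ℂ) * z + A 0 1 with hn
  set d := (A 1 0 : ℂ) * z + A 1 1 with hd
  have : ((A 1 0 : ℂ) * (n / d) ^ 2 + (A 1 1 - A 0 0) * (n / d) - A 0 1) * d ^ 2
      = (A 1 0 : ℂ) * n ^ 2 + (A 1 1 - A 0 0) * (n * d) - A 0 1 * d ^ 2 := by
    field_simp
  rw [mul_assoc, this, hn, hd]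
  linear_combination
    (-s * ((A 1 0 : ℂ) * z ^ 2 + (A 1 1 - A 0 0) * z - A 0 1)) * hdetC

theorem differentiableOn_cycleIntegrand {f : ℍ → ℂ}
    (hf : IsWeaklyHolomorphicModularFunction f) {A : SL(2, ℤ)}
    (h : (A : Matrix (Fin 2) (Fin 2) ℤ).IsHyperbolic) :
    DifferentiableOn ℂ (cycleIntegrand f A) {z | 0 < z.im} := by
  have h1 : DifferentiableOn ℂ (f ∘ UpperHalfPlane.ofComplex) {z | 0 < z.im} :=
    UpperHalfPlane.mdifferentiable_iff.mp hf.holomorphic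
  have h2 : DifferentiableOn ℂ (cycleQuad A) {z | 0 < z.im} := by
    unfold cycleQuad; fun_prop
  exact (h1.mul_const _).div h2 fun z hz => cycleQuad_ne_zero h hz

/-- The cycle integral does not depend on the base point. -/
theorem cycleIntegral_eq_cycleIntegralFrom {f : ℍ → ℂ}
    (hf : IsWeaklyHolomorphicModularFunction f) {A : SL(2, ℤ)}
    (h : (A : Matrix (Fin 2) (Fin 2) ℤ).IsHyperbolic) (τ₀ : ℍ) :
    cycleIntegral f A = cycleIntegralFrom f A τ₀ := by
  have hconv : Convex ℝ {z : ℂ | 0 < z.im} := convex_halfSpace_im_gt 0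
  have hopen : IsOpen {z : ℂ | 0 < z.im} := isOpen_lt continuous_const Complex.continuous_im
  have hdiff := differentiableOn_cycleIntegrand hf h
  obtain ⟨F, hF'⟩ := hconv.exists_forall_hasDerivWithinAt hdiff
  have hF : ∀ z : ℂ, 0 < z.im → HasDerivAt F (cycleIntegrand f A z) z := fun z hz =>
    (hF' z hz).hasDerivAt (hopen.mem_nhds hz)
  have hint : ∀ τ : ℍ, cycleIntegralFrom f A τ = F ((A • τ : ℍ) : ℂ) - F τ := by
    intro τ
    set d : ℂ := ((A • τ : ℍ) : ℂ) - τ with hd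
    have hmem : ∀ s ∈ Set.uIcc (0 : ℝ) 1, 0 < ((τ : ℂ) + s * d).im := by
      intro s hs
      rw [Set.uIcc_of_le zero_le_one] at hs
      have h1 : ((τ : ℂ) + s * d).im = (1 - s) * τ.im + s * (A • τ : ℍ).im := by
        simp [hd]; ring
      rw [h1]
      rcases hs.1.eq_or_lt with h0 | h0
      · rw [← h0]; simpa using τ.im_pos
      · have := mul_pos h0 (A • τ : ℍ).im_pos
        have := mul_nonneg (sub_nonneg.mpr hs.2) τ.im_pos.le
        linarith
    have hline : ∀ s : ℝ, HasDerivAt (fun s : ℝ => (τ : ℂ) + s * d) d s := by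
      intro s
      simpa using ((hasDerivAt_id s).ofReal_comp.mul_const d).const_add (τ : ℂ)
    have := intervalIntegral.integral_eq_sub_of_hasDerivAt
      (f := fun s : ℝ => F ((τ : ℂ) + s * d))
      (f' := fun s : ℝ => cycleIntegrand f A ((τ : ℂ) + s * d) * d) (a := 0) (b := 1)
      (fun s hs => HasDerivAt.comp_of_eq s (hF _ (hmem s hs)) (hline s) rfl)
      (by
        apply ContinuousOn.intervalIntegrable
        apply ContinuousOn.mul _ continuousOn_const
        exact hdiff.continuousOn.comp (by fun_prop) hmem)
    rw [cycleIntegralFrom, ← hd, this]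
    simp [hd]
  set m : ℂ → ℂ := fun z => ((A 0 0 : ℂ) * z + A 0 1) / ((A 1 0 : ℂ) * z + A 1 1) with hm
  have hcoe : ∀ τ : ℍ, ((A • τ : ℍ) : ℂ) = m τ := by
    intro τ
    rw [UpperHalfPlane.coe_specialLinearGroup_apply]
    simp [hm]
  have hdet : (A 0 0 : ℂ) * A 1 1 - A 0 1 * A 1 0 = 1 := by
    have := A.det_coe
    rw [Matrix.det_fin_two] at this
    exact_mod_cast this
  obtain ⟨hc, hg, -⟩ := content_spec h
  have hden : ∀ z : ℂ, 0 < z.im → (A 1 0 : ℂ) * z + A 1 1 ≠ 0 := by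
    intro z hz h0
    have := congrArg Complex.im h0
    simp at this
    rcases this with h1 | h1
    · exact hc h1
    · exact hz.ne' h1
  have hmder : ∀ z : ℂ, 0 < z.im →
      HasDerivAt m (1 / ((A 1 0 : ℂ) * z + A 1 1) ^ 2) z := by
    intro z hz
    have h1 : HasDerivAt (fun z : ℂ => (A 0 0 : ℂ) * z + A 0 1) (A 0 0 : ℂ) z := by
      simpa using ((hasDerivAt_id z).const_mul (A 0 0 : ℂ)).add_const (A 0 1 : ℂ)
    have h2 : HasDerivAt (fun z : ℂ => (A 1 0 : ℂ) * z + A 1 1) (A 1 0 : ℂ) z := by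
      simpa using ((hasDerivAt_id z).const_mul (A 1 0 : ℂ)).add_const (A 1 1 : ℂ)
    have h3 : ((A 0 0 : ℂ) * ((A 1 0 : ℂ) * z + A 1 1) - ((A 0 0 : ℂ) * z + A 0 1) * (A 1 0 : ℂ))
        = 1 := by linear_combination hdet
    have h4 := h1.div h2 (hden z hz)
    rw [h3] at h4
    exact h4
  have hmim : ∀ z : ℂ, 0 < z.im → 0 < (m z).im := by
    intro z hz
    have := hcoe ⟨z, hz⟩
    have h2 := (A • (⟨z, hz⟩ : ℍ)).im_pos
    rw [← UpperHalfPlane.coe_im, this] at h2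
    exact h2
  have hG : ∀ z ∈ {z : ℂ | 0 < z.im}, HasDerivAt (fun z => F (m z) - F z) 0 z := by
    intro z hz
    have h1 := ((hF _ (hmim z hz)).comp z (hmder z hz)).sub (hF z hz)
    have hfi : f (UpperHalfPlane.ofComplex (m z)) = f (UpperHalfPlane.ofComplex z) := by
      have e1 : UpperHalfPlane.ofComplex z = (⟨z, hz⟩ : ℍ) :=
        UpperHalfPlane.ofComplex_apply_of_im_pos hz
      have e2 : UpperHalfPlane.ofComplex (m z) = A • (⟨z, hz⟩ : ℍ) := by
        rw [show m z = ((A • (⟨z, hz⟩ : ℍ) : ℍ) : ℂ) from (hcoe ⟨z, hz⟩).symm]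
        exact UpperHalfPlane.ofComplex_apply _
      rw [e1, e2, hf.invariant]
    have hQ : cycleQuad A (m z) * ((A 1 0 : ℂ) * z + A 1 1) ^ 2 = cycleQuad A z :=
      mul_right_cancel₀ (b := (content A : ℂ)) (by exact_mod_cast hg)
        (cycleQuad_moebius A (hden z hz))
    have hd := hden z hz
    have q1 := cycleQuad_ne_zero h (hmim z hz)
    have h0 : cycleIntegrand f A (m z) * (1 / ((A 1 0 : ℂ) * z + A 1 1) ^ 2)
        - cycleIntegrand f A z = 0 := by
      simp only [cycleIntegrand, hfi, ← hQ]
      field_simp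
      simp
    rw [h0] at h1
    exact h1
  have hconst : ∀ x y : ℍ, F (m x) - F x = F (m y) - F y := by
    intro x y
    refine hopen.is_const_of_deriv_eq_zero hconv.isPreconnected
      (fun z hz => (hG z hz).differentiableAt.differentiableWithinAt)
      (fun z hz => (hG z hz).deriv) x.im_pos y.im_pos
  rw [cycleIntegral, if_pos h, hint, hint, hcoe, hcoe]
  exact hconst _ _

/-! ### Existence and uniqueness of the path -/

theorem mul_matT_apply (A : SL(2, ℤ)) :
    (A * matT) 0 0 = A 0 0 ∧ (A * matT) 0 1 = A 0 0 + A 0 1 ∧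
    (A * matT) 1 0 = A 1 0 ∧ (A * matT) 1 1 = A 1 0 + A 1 1 := by
  simp only [Matrix.SpecialLinearGroup.coe_mul, Matrix.mul_apply, Fin.sum_univ_two]
  simp [matT]

theorem mul_matV_apply (A : SL(2, ℤ)) :
    (A * matV) 0 0 = A 0 0 + A 0 1 ∧ (A * matV) 0 1 = A 0 1 ∧
    (A * matV) 1 0 = A 1 0 + A 1 1 ∧ (A * matV) 1 1 = A 1 1 := by
  simp only [Matrix.SpecialLinearGroup.coe_mul, Matrix.mul_apply, Fin.sum_univ_two]
  simp [matV]

theorem mul_matV_ne_mul_matT {A : SL(2, ℤ)} : A * matV ≠ A * matT := by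
  intro h
  have h1 := congrArg (fun B : SL(2, ℤ) => B 0 1) (mul_left_cancel h)
  simp [matV, matT] at h1

/-- `a - x c` for `A = (a, b; c, d)`. -/
def upperGap (x : ℝ) (A : SL(2, ℤ)) : ℝ := A 0 0 - x * A 1 0

/-- `x d - b` for `A = (a, b; c, d)`. -/
def lowerGap (x : ℝ) (A : SL(2, ℤ)) : ℝ := x * A 1 1 - A 0 1

theorem gaps_matT (x : ℝ) (A : SL(2, ℤ)) :
    upperGap x (A * matT) = upperGap x A ∧
    lowerGap x (A * matT) = lowerGap x A - upperGap x A := by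
  obtain ⟨h1, h2, h3, h4⟩ := mul_matT_apply A
  simp only [upperGap, lowerGap, h1, h2, h3, h4]
  push_cast
  exact ⟨trivial, by ring⟩

theorem gaps_matV (x : ℝ) (A : SL(2, ℤ)) :
    upperGap x (A * matV) = upperGap x A - lowerGap x A ∧
    lowerGap x (A * matV) = lowerGap x A := by
  obtain ⟨h1, h2, h3, h4⟩ := mul_matV_apply A
  simp only [upperGap, lowerGap, h1, h2, h3, h4]
  push_cast
  exact ⟨by ring, trivial⟩

/-- Sign conditions on the bottom row along a path. -/
theorem bottom_row {A : ℕ → SL(2, ℤ)} (h0 : A 0 = 1)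
    (hs : ∀ n, A (n + 1) = A n * matV ∨ A (n + 1) = A n * matT) (n : ℕ) :
    0 ≤ A n 1 0 ∧ 1 ≤ A n 1 1 := by
  induction n with
  | zero => rw [h0]; simp
  | succ n ih =>
    obtain ⟨-, -, v3, v4⟩ := mul_matV_apply (A n)
    obtain ⟨-, -, t3, t4⟩ := mul_matT_apply (A n)
    rcases hs n with h | h <;> rw [h]
    · rw [v3, v4]; omega
    · rw [t3, t4]; omega

theorem fareyFraction_eq {A : SL(2, ℤ)} (h : 0 ≤ A 1 0 ∧ 1 ≤ A 1 1) (x : ℝ) :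
    0 < ((A 1 0 : ℝ) + A 1 1) ∧
    ((fareyFraction A : ℚ) : ℝ) - x = (upperGap x A - lowerGap x A) / ((A 1 0 : ℝ) + A 1 1) := by
  have h1 : 0 < ((A 1 0 : ℝ) + A 1 1) := by
    have : 0 < A 1 0 + A 1 1 := by omega
    exact_mod_cast this
  refine ⟨h1, ?_⟩
  rw [fareyFraction, upperGap, lowerGap]
  push_cast
  field_simp
  ring

theorem lt_fareyFraction_iff {A : SL(2, ℤ)} (h : 0 ≤ A 1 0 ∧ 1 ≤ A 1 1) (x : ℝ) :
    x < (fareyFraction A : ℚ) ↔ lowerGap x A < upperGap x A := by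
  obtain ⟨h1, h2⟩ := fareyFraction_eq h x
  rw [← sub_pos, h2, div_pos_iff_of_pos_right h1, sub_pos]

theorem gap_det {A : SL(2, ℤ)} (x : ℝ) :
    (A 1 1 : ℝ) * upperGap x A + A 1 0 * lowerGap x A = 1 := by
  have h := A.det_coe
  rw [Matrix.det_fin_two] at h
  have h' : (A 0 0 : ℝ) * A 1 1 - A 0 1 * A 1 0 = 1 := by exact_mod_cast h
  rw [upperGap, lowerGap]
  linear_combination h'

theorem IsFareyPath.eq_fareyPath {x : ℝ} {A : ℕ → SL(2, ℤ)} (hA : IsFareyPath x A) :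
    A = fareyPath x := by
  have hrow := bottom_row hA.start hA.step
  have hmono : ∀ y : ℝ, ∀ n, 0 ≤ upperGap y (A (n + 1)) → 0 ≤ lowerGap y (A (n + 1)) →
      0 ≤ upperGap y (A n) ∧ 0 ≤ lowerGap y (A n) := by
    intro y n h1 h2
    rcases hA.step n with h | h <;> rw [h] at h1 h2
    · obtain ⟨g1, g2⟩ := gaps_matV y (A n)
      constructor <;> linarith
    · obtain ⟨g1, g2⟩ := gaps_matT y (A n)
      constructor <;> linarith
  have hself : ∀ k, 0 ≤ upperGap (fareyFraction (A k) : ℚ) (A k) ∧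
      0 ≤ lowerGap (fareyFraction (A k) : ℚ) (A k) := by
    intro k
    obtain ⟨h1, h2⟩ := fareyFraction_eq (hrow k) (fareyFraction (A k) : ℚ)
    have h3 := gap_det (A := A k) (fareyFraction (A k) : ℚ)
    rw [sub_self, eq_comm, div_eq_zero_iff] at h2
    have h4 := sub_eq_zero.mp (h2.resolve_right h1.ne')
    rw [← h4] at h3 ⊢
    have h5 : ((A k 1 0 : ℝ) + A k 1 1) * upperGap (fareyFraction (A k) : ℚ) (A k) = 1 := by
      linear_combination h3
    have : 0 ≤ upperGap (fareyFraction (A k) : ℚ) (A k) := by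
      by_contra h6
      nlinarith
    exact ⟨this, this⟩
  have hback : ∀ j n, 0 ≤ upperGap (fareyFraction (A (n + j)) : ℚ) (A n) ∧
      0 ≤ lowerGap (fareyFraction (A (n + j)) : ℚ) (A n) := by
    intro j
    induction j with
    | zero => intro n; exact hself n
    | succ j ih =>
      intro n
      have := ih (n + 1)
      rw [show n + 1 + j = n + (j + 1) by ring] at this
      exact hmono _ n this.1 this.2
  have hlim : ∀ n, 0 ≤ upperGap x (A n) ∧ 0 ≤ lowerGap x (A n) := by
    intro n
    have ht : Filter.Tendsto (fun j => ((fareyFraction (A (n + j)) : ℚ) : ℝ)) Filter.atTop (𝓝 x) := by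
      have := (Filter.tendsto_add_atTop_iff_nat n).mpr hA.tendsto
      simpa only [add_comm] using this
    constructor
    · refine ge_of_tendsto' (x := Filter.atTop) (f := fun j => upperGap (fareyFraction (A (n + j)) : ℚ) (A n)) ?_
        fun j => (hback j n).1
      exact (ht.mul_const _).const_sub _
    · refine ge_of_tendsto' (x := Filter.atTop) (f := fun j => lowerGap (fareyFraction (A (n + j)) : ℚ) (A n)) ?_
        fun j => (hback j n).2
      exact (ht.mul_const _).sub_const _
  have hdecr : ∀ n, upperGap x (A (n + 1)) ≤ upperGap x (A n) := by
    intro n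
    rcases hA.step n with h | h <;> rw [h]
    · rw [(gaps_matV x (A n)).1]; linarith [(hlim n).2]
    · rw [(gaps_matT x (A n)).1]
  have hanti : Antitone fun n => upperGap x (A n) := antitone_nat_of_succ_le hdecr
  have hpos : ∀ n, 0 < upperGap x (A n) := by
    intro n
    refine (hlim n).1.lt_of_ne' ?_
    intro h0
    have hz : ∀ k, n ≤ k → upperGap x (A k) = 0 := fun k hk =>
      le_antisymm (h0 ▸ hanti hk) (hlim k).1
    obtain ⟨k, hk, hV⟩ := (Filter.frequently_atTop.mp hA.frequently) n
    have h1 := hz k hk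
    have h2 := hz (k + 1) (by omega)
    rw [hV, (gaps_matV x (A k)).1, h1] at h2
    have h3 := gap_det (A := A k) x
    rw [h1, show lowerGap x (A k) = 0 by linarith] at h3
    simp at h3
  funext n
  induction n with
  | zero => exact hA.start
  | succ n ih =>
    rw [fareyPath, ← ih]
    rcases hA.step n with h | h
    · rw [if_pos, h]
      rw [lt_fareyFraction_iff (hrow n)]
      have := hpos (n + 1)
      rw [h, (gaps_matV x (A n)).1] at this
      linarith
    · rw [if_neg, h]
      rw [lt_fareyFraction_iff (hrow n), not_lt]
      have := (hlim (n + 1)).2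
      rw [h, (gaps_matT x (A n)).2] at this
      linarith

theorem fareyPath_succ (x : ℝ) (n : ℕ) :
    fareyPath x (n + 1) = fareyPath x n * matV ∨ fareyPath x (n + 1) = fareyPath x n * matT := by
  rw [fareyPath]
  split_ifs
  · exact Or.inl rfl
  · exact Or.inr rfl

theorem isFareyPath_fareyPath {x : ℝ} (hx : 0 < x) : IsFareyPath x (fareyPath x) := by
  have hstep := fareyPath_succ x
  have hrow := bottom_row (A := fareyPath x) rfl hstep
  have hcase : ∀ n, (fareyPath x (n + 1) = fareyPath x n * matV ∧
      lowerGap x (fareyPath x n) < upperGap x (fareyPath x n)) ∨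
      (fareyPath x (n + 1) = fareyPath x n * matT ∧
      upperGap x (fareyPath x n) ≤ lowerGap x (fareyPath x n)) := by
    intro n
    have := lt_fareyFraction_iff (hrow n) x
    rw [fareyPath]
    split_ifs with h
    · exact Or.inl ⟨rfl, this.mp h⟩
    · exact Or.inr ⟨rfl, not_lt.mp fun h' => h (this.mpr h')⟩
  have hgap : ∀ n, (0 < upperGap x (fareyPath x n) ∧ upperGap x (fareyPath x n) ≤ 1) ∧
      0 ≤ lowerGap x (fareyPath x n) ∧ lowerGap x (fareyPath x n) ≤ x := by
    intro n
    induction n with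
    | zero => simp [fareyPath, upperGap, lowerGap, hx.le]
    | succ n ih =>
      obtain ⟨⟨i1, i2⟩, i3, i4⟩ := ih
      rcases hcase n with ⟨h, h'⟩ | ⟨h, h'⟩ <;> rw [h]
      · rw [(gaps_matV x _).1, (gaps_matV x _).2]
        exact ⟨⟨by linarith, by linarith⟩, i3, i4⟩
      · rw [(gaps_matT x _).1, (gaps_matT x _).2]
        exact ⟨⟨i1, i2⟩, by linarith, by linarith⟩
  have hfreq : ∃ᶠ n in Filter.atTop, fareyPath x (n + 1) = fareyPath x n * matV := by
    rw [Filter.frequently_atTop]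
    intro N
    by_contra hno
    push Not at hno
    have hT : ∀ k, N ≤ k → fareyPath x (k + 1) = fareyPath x k * matT := fun k hk =>
      (hstep k).resolve_left (hno k hk)
    have hk : ∀ k : ℕ, upperGap x (fareyPath x (N + k)) = upperGap x (fareyPath x N) ∧
        lowerGap x (fareyPath x (N + k))
          = lowerGap x (fareyPath x N) - k * upperGap x (fareyPath x N) := by
      intro k
      induction k with
      | zero => simp
      | succ k ih =>
        rw [← add_assoc, hT (N + k) (by omega), (gaps_matT x _).1, (gaps_matT x _).2, ih.1, ih.2]
        push_cast
        exact ⟨rfl, by ring⟩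
    obtain ⟨k, hk'⟩ := exists_nat_gt (lowerGap x (fareyPath x N) / upperGap x (fareyPath x N))
    rw [div_lt_iff₀ (hgap N).1.1] at hk'
    have := (hgap (N + k)).2.1
    rw [(hk k).2] at this
    linarith
  refine ⟨rfl, hstep, ?_, hfreq⟩
  obtain ⟨N, -, hN⟩ := (Filter.frequently_atTop.mp hfreq) 0
  have hgrow : ∀ k : ℕ, 1 ≤ fareyPath x (N + 1 + k) 1 0 ∧
      (k : ℤ) ≤ fareyPath x (N + 1 + k) 1 0 + fareyPath x (N + 1 + k) 1 1 := by
    intro k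
    induction k with
    | zero =>
      have h1 := hrow N
      obtain ⟨-, -, v3, v4⟩ := mul_matV_apply (fareyPath x N)
      rw [add_zero, hN, v3, v4]
      push_cast
      omega
    | succ k ih =>
      have h1 := hrow (N + 1 + k)
      obtain ⟨-, -, v3, v4⟩ := mul_matV_apply (fareyPath x (N + 1 + k))
      obtain ⟨-, -, t3, t4⟩ := mul_matT_apply (fareyPath x (N + 1 + k))
      rw [← add_assoc]
      rcases hstep (N + 1 + k) with h | h <;> rw [h]
      · rw [v3, v4]; push_cast; omega
      · rw [t3, t4]; push_cast; omega
  rw [← Filter.tendsto_add_atTop_iff_nat (N + 1), tendsto_iff_dist_tendsto_zero]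
  refine squeeze_zero' (g := fun k : ℕ => (1 + x) / k) (Filter.Eventually.of_forall fun _ => dist_nonneg) ?_
    (tendsto_const_div_atTop_nhds_zero_nat _)
  filter_upwards [Filter.eventually_gt_atTop 0] with k hk
  rw [add_comm k (N + 1), Real.dist_eq]
  obtain ⟨h1, h2⟩ := fareyFraction_eq (hrow (N + 1 + k)) x
  rw [h2, abs_div, abs_of_pos h1]
  have h3 : (k : ℝ) ≤ (fareyPath x (N + 1 + k) 1 0 : ℝ) + fareyPath x (N + 1 + k) 1 1 := by
    exact_mod_cast (hgrow k).2
  obtain ⟨⟨g1, g2⟩, g3, g4⟩ := hgap (N + 1 + k)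
  apply div_le_div₀ (by linarith) _ (by exact_mod_cast hk) h3
  rw [abs_le]
  constructor <;> linarith

/-- For `x > 0` there is exactly one sequence `A` with `IsFareyPath x A`, namely `fareyPath x`. -/
theorem isFareyPath_iff {x : ℝ} (hx : 0 < x) (A : ℕ → SL(2, ℤ)) :
    IsFareyPath x A ↔ A = fareyPath x :=
  ⟨fun h => h.eq_fareyPath, fun h => h ▸ isFareyPath_fareyPath hx⟩

end FareyLyapunov

namespace FareyLyapunov

/-! ### Words in `T` and `V` and their real Möbius action -/

/-! Both `T` and `V` send the left end `ρ = exp (2πi/3)` of the arc to its right end `exp (πi/3)`.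
With `ρ` as base point, the path from `ρ` to `A_n ρ` can therefore run through the points `A_k ρ`,
and the piece from `A_k ρ` to `A_{k+1} ρ` is the image of the arc under `A_k`. Pulled back by `A_k`,
this piece is an integral over the arc itself, with `A_n` replaced by its conjugate `A_k⁻¹ A_n A_k`.
This conjugate is again a word in `T` and `V`; it has one fixed point `u > 0` and one fixed point
`-v < 0`. As `f` is real on the arc, the real part of the piece is `h(u) + h(v)`, where `h =
arcWeight f` integrates `f(exp (it)) sin t · x / |exp (it) - x|²` over the arc (`re_primitive_sub`).

The point `u` lies in the image of `(0, ∞)` under `A_k⁻¹ A_n`, and `v` in its image under the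
reversal of the word `A_k`. In the coordinate `x / (1 + x)`, where `h` is Lipschitz, a word of
length `j` contracts `(0, ∞)` to length at most `1 / (j + 1)` (`IsFareyWord.contraction`). Replacing
`u` and `v` by the images of `1` thus costs only a harmonic sum, which is `o(n)`. Hence the exponent
is the limsup of `treeSum h A n / n`, which depends only on the word
(`lyapunovExponent_eq_treeExponent`).

The rest is about words. Boundedness of `h` gives finiteness. Prepending a letter changes the sum by
`o(n)`, hence invariance under `x ↦ x + 1` and `x ↦ x / (1 + x)`; exchanging `T` and `V` corresponds
to `x ↦ 1 / x`, and `h(1/x) = h(x)`. The Euclidean algorithm carries every non-negative rational to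
`0`, whose word is `V^n`; there the terms of the sum decay harmonically, so the exponent is `0`.
Extending by `Λ(x) = Λ(|x|)` and `Λ(∞) = 0` gives invariance under generators of `GL(2, ℤ)`. -/

theorem det_eq_one (A : SL(2, ℤ)) : A 0 0 * A 1 1 - A 0 1 * A 1 0 = 1 := by
  have := A.det_coe
  rwa [Matrix.det_fin_two] at this

theorem mul_apply_entries (A B : SL(2, ℤ)) :
    (A * B) 0 0 = A 0 0 * B 0 0 + A 0 1 * B 1 0 ∧ (A * B) 0 1 = A 0 0 * B 0 1 + A 0 1 * B 1 1 ∧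
    (A * B) 1 0 = A 1 0 * B 0 0 + A 1 1 * B 1 0 ∧ (A * B) 1 1 = A 1 0 * B 0 1 + A 1 1 * B 1 1 := by
  simp only [Matrix.SpecialLinearGroup.coe_mul, Matrix.mul_apply, Fin.sum_univ_two]
  exact ⟨trivial, trivial, trivial, trivial⟩

theorem ext_entries {A B : SL(2, ℤ)} (h1 : A 0 0 = B 0 0) (h2 : A 0 1 = B 0 1)
    (h3 : A 1 0 = B 1 0) (h4 : A 1 1 = B 1 1) : A = B := by
  ext i j
  fin_cases i <;> fin_cases j <;> assumption

/-- Products of `n` matrices from `{T, V}`. -/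
inductive IsFareyWord : ℕ → SL(2, ℤ) → Prop
  | one : IsFareyWord 0 1
  | mul_matV {n : ℕ} {A : SL(2, ℤ)} : IsFareyWord n A → IsFareyWord (n + 1) (A * matV)
  | mul_matT {n : ℕ} {A : SL(2, ℤ)} : IsFareyWord n A → IsFareyWord (n + 1) (A * matT)

theorem IsFareyWord.bounds {n : ℕ} {A : SL(2, ℤ)} (h : IsFareyWord n A) :
    1 ≤ A 0 0 ∧ 0 ≤ A 0 1 ∧ 0 ≤ A 1 0 ∧ 1 ≤ A 1 1 ∧
      (n : ℤ) + 2 ≤ (A 0 0 + A 1 0) + (A 0 1 + A 1 1) := by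
  induction h with
  | one => simp
  | @mul_matV n A _ ih =>
    obtain ⟨v1, v2, v3, v4⟩ := mul_matV_apply A
    rw [v1, v2, v3, v4]; push_cast; omega
  | @mul_matT n A _ ih =>
    obtain ⟨v1, v2, v3, v4⟩ := mul_matT_apply A
    rw [v1, v2, v3, v4]; push_cast; omega

theorem isFareyWord_matT : IsFareyWord 1 matT := by
  simpa using IsFareyWord.one.mul_matT

theorem isFareyWord_matV : IsFareyWord 1 matV := by
  simpa using IsFareyWord.one.mul_matV

theorem IsFareyWord.mul {m n : ℕ} {A B : SL(2, ℤ)} (hA : IsFareyWord m A)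
    (hB : IsFareyWord n B) : IsFareyWord (m + n) (A * B) := by
  induction hB with
  | one => simpa using hA
  | mul_matV _ ih => rw [← mul_assoc, ← add_assoc]; exact ih.mul_matV
  | mul_matT _ ih => rw [← mul_assoc, ← add_assoc]; exact ih.mul_matT

/-- The anti-automorphism `(a, b; c, d) ↦ (d, b; c, a)`, which reverses words in `T` and `V`. -/
def wordRev (A : SL(2, ℤ)) : SL(2, ℤ) :=
  ⟨!![A 1 1, A 0 1; A 1 0, A 0 0], by
    rw [Matrix.det_fin_two_of]; linear_combination det_eq_one A⟩

/-- The automorphism `(a, b; c, d) ↦ (d, c; b, a)`, which exchanges `T` and `V`. -/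
def wordFlip (A : SL(2, ℤ)) : SL(2, ℤ) :=
  ⟨!![A 1 1, A 1 0; A 0 1, A 0 0], by
    rw [Matrix.det_fin_two_of]; linear_combination det_eq_one A⟩

theorem wordRev_apply (A : SL(2, ℤ)) : wordRev A 0 0 = A 1 1 ∧ wordRev A 0 1 = A 0 1 ∧
    wordRev A 1 0 = A 1 0 ∧ wordRev A 1 1 = A 0 0 := by
  simp [wordRev]

theorem wordFlip_apply (A : SL(2, ℤ)) : wordFlip A 0 0 = A 1 1 ∧ wordFlip A 0 1 = A 1 0 ∧
    wordFlip A 1 0 = A 0 1 ∧ wordFlip A 1 1 = A 0 0 := by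
  simp [wordFlip]

theorem wordRev_mul (A B : SL(2, ℤ)) : wordRev (A * B) = wordRev B * wordRev A := by
  obtain ⟨m1, m2, m3, m4⟩ := mul_apply_entries A B
  obtain ⟨n1, n2, n3, n4⟩ := mul_apply_entries (wordRev B) (wordRev A)
  obtain ⟨a1, a2, a3, a4⟩ := wordRev_apply A
  obtain ⟨b1, b2, b3, b4⟩ := wordRev_apply B
  obtain ⟨c1, c2, c3, c4⟩ := wordRev_apply (A * B)
  apply ext_entries
  · rw [c1, n1, m4, a1, b1, b2, a3]; ring
  · rw [c2, n2, m2, a2, b1, b2, a4]; ring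
  · rw [c3, n3, m3, a1, b3, b4, a3]; ring
  · rw [c4, n4, m1, a2, b3, b4, a4]; ring

theorem wordFlip_mul (A B : SL(2, ℤ)) : wordFlip (A * B) = wordFlip A * wordFlip B := by
  obtain ⟨m1, m2, m3, m4⟩ := mul_apply_entries A B
  obtain ⟨n1, n2, n3, n4⟩ := mul_apply_entries (wordFlip A) (wordFlip B)
  obtain ⟨a1, a2, a3, a4⟩ := wordFlip_apply A
  obtain ⟨b1, b2, b3, b4⟩ := wordFlip_apply B
  obtain ⟨c1, c2, c3, c4⟩ := wordFlip_apply (A * B)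
  apply ext_entries
  · rw [c1, n1, m4, a1, a2, b1, b3]; ring
  · rw [c2, n2, m3, a1, a2, b2, b4]; ring
  · rw [c3, n3, m2, a3, a4, b1, b3]; ring
  · rw [c4, n4, m1, a3, a4, b2, b4]; ring

theorem wordRev_one : wordRev 1 = 1 := by
  apply ext_entries <;> simp [wordRev]

theorem wordFlip_one : wordFlip 1 = 1 := by
  apply ext_entries <;> simp [wordFlip]

theorem wordRev_matT : wordRev matT = matT := by
  apply ext_entries <;> simp [wordRev, matT]

theorem wordRev_matV : wordRev matV = matV := by
  apply ext_entries <;> simp [wordRev, matV]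

theorem wordFlip_matT : wordFlip matT = matV := by
  apply ext_entries <;> simp [wordFlip, matT, matV]

theorem wordFlip_matV : wordFlip matV = matT := by
  apply ext_entries <;> simp [wordFlip, matT, matV]

theorem wordFlip_inv_mul (A B : SL(2, ℤ)) : wordFlip (A⁻¹ * B) = (wordFlip A)⁻¹ * wordFlip B := by
  rw [eq_inv_mul_iff_mul_eq, ← wordFlip_mul, mul_inv_cancel_left]

theorem IsFareyWord.rev {n : ℕ} {A : SL(2, ℤ)} (h : IsFareyWord n A) :
    IsFareyWord n (wordRev A) := by
  induction h with
  | one => rw [wordRev_one]; exact .one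
  | mul_matV _ ih =>
    rw [wordRev_mul, wordRev_matV, add_comm]; exact isFareyWord_matV.mul ih
  | mul_matT _ ih =>
    rw [wordRev_mul, wordRev_matT, add_comm]; exact isFareyWord_matT.mul ih

/-- The Möbius transformation of `A` on the real line. -/
noncomputable def realMoebius (A : SL(2, ℤ)) (x : ℝ) : ℝ :=
  ((A 0 0 : ℝ) * x + A 0 1) / ((A 1 0 : ℝ) * x + A 1 1)

theorem IsFareyWord.bounds_real {n : ℕ} {A : SL(2, ℤ)} (h : IsFareyWord n A) :
    1 ≤ (A 0 0 : ℝ) ∧ 0 ≤ (A 0 1 : ℝ) ∧ 0 ≤ (A 1 0 : ℝ) ∧ 1 ≤ (A 1 1 : ℝ) ∧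
      (n : ℝ) + 2 ≤ ((A 0 0 : ℝ) + A 1 0) + (A 0 1 + A 1 1) := by
  obtain ⟨h1, h2, h3, h4, h5⟩ := h.bounds
  exact ⟨by exact_mod_cast h1, by exact_mod_cast h2, by exact_mod_cast h3, by exact_mod_cast h4,
    by exact_mod_cast h5⟩

theorem IsFareyWord.den_pos {n : ℕ} {A : SL(2, ℤ)} (h : IsFareyWord n A) {x : ℝ} (hx : 0 < x) :
    0 < (A 1 0 : ℝ) * x + A 1 1 := by
  obtain ⟨h1, h2, h3, h4, -⟩ := h.bounds_real
  positivity

theorem IsFareyWord.realMoebius_pos {n : ℕ} {A : SL(2, ℤ)} (h : IsFareyWord n A) {x : ℝ}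
    (hx : 0 < x) : 0 < realMoebius A x := by
  have h6 := h.den_pos hx
  obtain ⟨h1, h2, h3, h4, -⟩ := h.bounds_real
  unfold realMoebius
  positivity

theorem IsFareyWord.realMoebius_mul {n : ℕ} {A B : SL(2, ℤ)} {m : ℕ} (hA : IsFareyWord m A)
    (hB : IsFareyWord n B) {x : ℝ} (hx : 0 < x) :
    realMoebius (A * B) x = realMoebius A (realMoebius B x) := by
  have h1 := hB.den_pos hx
  have h2 := hA.den_pos (hB.realMoebius_pos hx)
  have h3 := (hA.mul hB).den_pos hx
  obtain ⟨m1, m2, m3, m4⟩ := mul_apply_entries A B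
  rw [realMoebius] at h2 ⊢
  rw [realMoebius, realMoebius]
  rw [div_eq_div_iff h3.ne' h2.ne', m1, m2, m3, m4]
  push_cast
  field_simp
  ring

/-- `wordFlip` is conjugation by `x ↦ 1 / x`, which fixes `1`. -/
theorem realMoebius_wordFlip_one (A : SL(2, ℤ)) :
    realMoebius (wordFlip A) 1 = (realMoebius A 1)⁻¹ := by
  obtain ⟨a1, a2, a3, a4⟩ := wordFlip_apply A
  rw [realMoebius, realMoebius, a1, a2, a3, a4, inv_div]
  ring

/-- A word of length `n` contracts `(0, ∞)` by a factor of `n + 1` in the coordinate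
`x / (1 + x)`. -/
theorem IsFareyWord.contraction {n : ℕ} {A : SL(2, ℤ)} (h : IsFareyWord n A) {x y : ℝ}
    (hx : 0 < x) (hy : 0 < y) :
    |realMoebius A x / (1 + realMoebius A x) - realMoebius A y / (1 + realMoebius A y)|
      ≤ 1 / (n + 1) := by
  have dx := h.den_pos hx
  have dy := h.den_pos hy
  have px := h.realMoebius_pos hx
  have py := h.realMoebius_pos hy
  have hdet : (A 0 0 : ℝ) * A 1 1 - A 0 1 * A 1 0 = 1 := by exact_mod_cast det_eq_one A
  obtain ⟨h1, h2, h3, h4, h5⟩ := h.bounds_real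
  set p : ℝ := (A 0 0 : ℝ) + A 1 0 with hp
  set q : ℝ := (A 0 1 : ℝ) + A 1 1 with hq
  have hp1 : 1 ≤ p := by linarith
  have hq1 : 1 ≤ q := by linarith
  have e : ∀ z : ℝ, 0 < z → realMoebius A z / (1 + realMoebius A z)
      = (A 0 0 * z + A 0 1) / (p * z + q) := by
    intro z hz
    have dz := h.den_pos hz
    have pz := h.realMoebius_pos hz
    have : 0 < p * z + q := by positivity
    rw [realMoebius] at pz ⊢
    rw [div_eq_div_iff (by positivity) (by positivity), hp, hq]
    field_simp
    ring
  have sx : 0 < p * x + q := by positivity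
  have sy : 0 < p * y + q := by positivity
  rw [e x hx, e y hy, div_sub_div _ _ sx.ne' sy.ne']
  have : ((A 0 0 * x + A 0 1) * (p * y + q) - (p * x + q) * (A 0 0 * y + A 0 1)) = x - y := by
    rw [hp, hq]; linear_combination (x - y) * hdet
  rw [this, abs_div, abs_of_pos (mul_pos sx sy), div_le_div_iff₀ (mul_pos sx sy) (by positivity)]
  -- From `(p - 1) (q - 1) ≥ 0` one gets `p q ≥ p + q - 1`. In the estimate below, `p q (x + y)` is
  -- the mixed part of `(p x + q) (p y + q)`.
  have hpq : (n : ℝ) + 1 ≤ p * q := by nlinarith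
  have habs : |x - y| ≤ x + y := by rw [abs_le]; constructor <;> linarith
  have hn : (0 : ℝ) ≤ n := Nat.cast_nonneg n
  calc |x - y| * (n + 1) ≤ (x + y) * (p * q) := by gcongr
    _ ≤ 1 * ((p * x + q) * (p * y + q)) := by
      have : 0 ≤ p ^ 2 * (x * y) + q ^ 2 := by positivity
      nlinarith

/-! ### Paths -/

/-- Sequences that start at the identity and whose steps are right multiplications by `T` or
`V`. -/
def IsWordPath (A : ℕ → SL(2, ℤ)) : Prop :=
  A 0 = 1 ∧ ∀ n, A (n + 1) = A n * matV ∨ A (n + 1) = A n * matT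

theorem isWordPath_fareyPath (x : ℝ) : IsWordPath (fareyPath x) :=
  ⟨rfl, fareyPath_succ x⟩

theorem IsWordPath.isFareyWord_between {A : ℕ → SL(2, ℤ)} (h : IsWordPath A) (k j : ℕ) :
    IsFareyWord j ((A k)⁻¹ * A (k + j)) := by
  induction j with
  | zero => simpa using IsFareyWord.one
  | succ j ih =>
    rw [← add_assoc]
    rcases h.2 (k + j) with h' | h' <;> rw [h', ← mul_assoc]
    exacts [ih.mul_matV, ih.mul_matT]

theorem IsWordPath.isFareyWord {A : ℕ → SL(2, ℤ)} (h : IsWordPath A) (n : ℕ) :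
    IsFareyWord n (A n) := by
  simpa [h.1] using h.isFareyWord_between 0 n

theorem IsWordPath.isFareyWord_tail {A : ℕ → SL(2, ℤ)} (h : IsWordPath A) {k n : ℕ}
    (hk : k ≤ n) : IsFareyWord (n - k) ((A k)⁻¹ * A n) := by
  obtain ⟨j, rfl⟩ := Nat.exists_eq_add_of_le hk
  simpa using h.isFareyWord_between k j

/-- A function on `(0, ∞)` that is invariant under inversion, vanishes at `0` and `∞`, and is
Lipschitz in the coordinate `x / (1 + x)`. -/
structure IsTreeWeight (h : ℝ → ℝ) (C : ℝ) : Prop where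
  inv : ∀ x, 0 < x → h x⁻¹ = h x
  abs_le : ∀ x, 0 < x → |h x| ≤ C * (x / (1 + x))
  abs_sub_le : ∀ x y, 0 < x → 0 < y → |h x - h y| ≤ C * |x / (1 + x) - y / (1 + y)|

theorem IsTreeWeight.nonneg {h : ℝ → ℝ} {C : ℝ} (hh : IsTreeWeight h C) : 0 ≤ C := by
  have := (abs_nonneg _).trans (hh.abs_le 1 one_pos)
  linarith

theorem IsTreeWeight.abs_le_const {h : ℝ → ℝ} {C : ℝ} (hh : IsTreeWeight h C) {x : ℝ}
    (hx : 0 < x) : |h x| ≤ C := by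
  refine (hh.abs_le x hx).trans (mul_le_of_le_one_right hh.nonneg ?_)
  rw [div_le_one (by positivity)]
  linarith

theorem IsTreeWeight.abs_sub_word_le {h : ℝ → ℝ} {C : ℝ} (hh : IsTreeWeight h C) {n : ℕ}
    {A : SL(2, ℤ)} (hA : IsFareyWord n A) {x y : ℝ} (hx : 0 < x) (hy : 0 < y) :
    |h (realMoebius A x) - h (realMoebius A y)| ≤ C * (1 / (n + 1)) :=
  (hh.abs_sub_le _ _ (hA.realMoebius_pos hx) (hA.realMoebius_pos hy)).trans
    (mul_le_mul_of_nonneg_left (hA.contraction hx hy) hh.nonneg)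

/-- The sum of the values of `h` at the endpoints of the geodesics seen from the vertices of a
path of length `n`. -/
noncomputable def treeSum (h : ℝ → ℝ) (A : ℕ → SL(2, ℤ)) (n : ℕ) : ℝ :=
  ∑ k ∈ Finset.range n,
    (h (realMoebius ((A k)⁻¹ * A n) 1) + h (realMoebius (wordRev (A k)) 1))

theorem abs_treeSum_le {h : ℝ → ℝ} {C : ℝ} (hh : IsTreeWeight h C) {A : ℕ → SL(2, ℤ)}
    (hA : IsWordPath A) (n : ℕ) : |treeSum h A n| ≤ 2 * C * n := by
  refine (Finset.abs_sum_le_sum_abs _ _).trans ?_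
  have : ∀ k ∈ Finset.range n, |h (realMoebius ((A k)⁻¹ * A n) 1)
      + h (realMoebius (wordRev (A k)) 1)| ≤ 2 * C := by
    intro k hk
    have hk' := (Finset.mem_range.mp hk).le
    have h1 := hh.abs_le_const ((hA.isFareyWord_tail hk').realMoebius_pos one_pos)
    have h2 := hh.abs_le_const ((hA.isFareyWord k).rev.realMoebius_pos one_pos)
    exact (abs_add_le _ _).trans (by linarith)
  refine (Finset.sum_le_sum this).trans ?_
  simp [mul_comm]

/-- The harmonic sums, which measure the error terms. -/
noncomputable def harmonicSum (n : ℕ) : ℝ := ∑ k ∈ Finset.range n, (1 / ((k : ℝ) + 1))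

theorem harmonicSum_reflect (n : ℕ) :
    ∑ k ∈ Finset.range n, (1 / (((n - k : ℕ) : ℝ) + 1)) ≤ harmonicSum n := by
  rw [harmonicSum, ← Finset.sum_range_reflect (fun k : ℕ => 1 / ((k : ℝ) + 1))]
  refine Finset.sum_le_sum fun k hk => ?_
  have hk' := Finset.mem_range.mp hk
  apply one_div_le_one_div_of_le (by positivity)
  have : n - 1 - k ≤ n - k := by omega
  have : ((n - 1 - k : ℕ) : ℝ) ≤ ((n - k : ℕ) : ℝ) := by exact_mod_cast this
  linarith

/-- Cesàro: these are the averages of the null sequence `1 / (k + 1)`. -/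
theorem tendsto_harmonicSum_div :
    Filter.Tendsto (fun n : ℕ => harmonicSum n / n) Filter.atTop (𝓝 0) := by
  have := (tendsto_one_div_add_atTop_nhds_zero_nat (𝕜 := ℝ)).cesaro
  refine this.congr fun n => ?_
  rw [harmonicSum, div_eq_inv_mul]

/-- If every vertex `A k` contributes the value of `h` at points seen through the words
`(A k)⁻¹ * A n` and `wordRev (A k)`, then the total is `treeSum h A n` up to a harmonic sum. -/
theorem abs_sum_sub_treeSum_le {h : ℝ → ℝ} {C : ℝ} (hh : IsTreeWeight h C) {A : ℕ → SL(2, ℤ)}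
    (hA : IsWordPath A) (n : ℕ) {u v : ℕ → ℝ}
    (hu : ∀ k < n, ∃ y, 0 < y ∧ u k = realMoebius ((A k)⁻¹ * A n) y)
    (hv : ∀ k < n, ∃ y, 0 < y ∧ v k = realMoebius (wordRev (A k)) y) :
    |∑ k ∈ Finset.range n, (h (u k) + h (v k)) - treeSum h A n| ≤ 2 * C * harmonicSum n := by
  rw [treeSum, ← Finset.sum_sub_distrib]
  refine (Finset.abs_sum_le_sum_abs _ _).trans ?_
  have key : ∀ k ∈ Finset.range n, |h (u k) + h (v k) - (h (realMoebius ((A k)⁻¹ * A n) 1)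
      + h (realMoebius (wordRev (A k)) 1))|
      ≤ C * (1 / (((n - k : ℕ) : ℝ) + 1)) + C * (1 / ((k : ℝ) + 1)) := by
    intro k hk
    have hk' := Finset.mem_range.mp hk
    obtain ⟨y, hy, hy'⟩ := hu k hk'
    obtain ⟨z, hz, hz'⟩ := hv k hk'
    rw [hy', hz', add_sub_add_comm]
    exact (abs_add_le _ _).trans (add_le_add
      (hh.abs_sub_word_le (hA.isFareyWord_tail hk'.le) hy one_pos)
      (hh.abs_sub_word_le (hA.isFareyWord k).rev hz one_pos))
  refine (Finset.sum_le_sum key).trans ?_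
  rw [Finset.sum_add_distrib, ← Finset.mul_sum, ← Finset.mul_sum]
  have := mul_le_mul_of_nonneg_left (harmonicSum_reflect n) hh.nonneg
  rw [harmonicSum] at this ⊢
  linarith

/-- Prepending a letter to a path changes `treeSum` only by a harmonic sum. -/
theorem abs_treeSum_cons_sub_le {h : ℝ → ℝ} {C : ℝ} (hh : IsTreeWeight h C)
    {A A' : ℕ → SL(2, ℤ)} (hA : IsWordPath A) (hA' : IsWordPath A') {W : SL(2, ℤ)}
    (hW : IsFareyWord 1 W) (hcons : ∀ n, A' (n + 1) = W * A n) (n : ℕ) :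
    |treeSum h A' (n + 1) - treeSum h A n| ≤ 2 * C + C * harmonicSum n := by
  -- The vertex `0` of the longer path is split off and costs `2 * C`; its vertex `k + 1` is
  -- compared with the vertex `k` of the shorter path.
  rw [treeSum, Finset.sum_range_succ', treeSum, add_sub_right_comm, ← Finset.sum_sub_distrib,
    add_comm]
  refine (abs_add_le _ _).trans (add_le_add ?_ ?_)
  · have h1 := hh.abs_le_const
      ((hA'.isFareyWord_tail (Nat.zero_le (n + 1))).realMoebius_pos one_pos)
    have h2 := hh.abs_le_const ((hA'.isFareyWord 0).rev.realMoebius_pos one_pos)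
    exact (abs_add_le _ _).trans (by linarith)
  · refine (Finset.abs_sum_le_sum_abs _ _).trans ?_
    rw [harmonicSum, Finset.mul_sum]
    refine Finset.sum_le_sum fun k hk => ?_
    -- The forward words `(A k)⁻¹ * A n` agree, since `W` cancels. The reversed word only has
    -- `wordRev W` appended on the right, so both values of `h` are taken at images under the same
    -- word `wordRev (A k)`.
    rw [hcons, hcons, mul_inv_rev, mul_assoc, inv_mul_cancel_left, wordRev_mul,
      add_sub_add_left_eq_sub, (hA.isFareyWord k).rev.realMoebius_mul hW.rev one_pos]
    exact hh.abs_sub_word_le (hA.isFareyWord k).rev (hW.rev.realMoebius_pos one_pos) one_pos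

/-- Exchanging the letters inverts every point at which `h` is evaluated, and `h` is invariant under
inversion. -/
theorem IsWordPath.treeSum_flip {h : ℝ → ℝ} {C : ℝ} (hh : IsTreeWeight h C)
    {A A' : ℕ → SL(2, ℤ)} (hA : IsWordPath A) (hflip : ∀ n, A' n = wordFlip (A n)) (n : ℕ) :
    treeSum h A' n = treeSum h A n := by
  refine Finset.sum_congr rfl fun k hk => ?_
  have hk' := (Finset.mem_range.mp hk).le
  have hcomm : wordRev (wordFlip (A k)) = wordFlip (wordRev (A k)) := by
    apply ext_entries <;> simp [wordRev, wordFlip]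
  rw [hflip, hflip, ← wordFlip_inv_mul, hcomm,
    realMoebius_wordFlip_one, realMoebius_wordFlip_one,
    hh.inv _ ((hA.isFareyWord_tail hk').realMoebius_pos one_pos),
    hh.inv _ ((hA.isFareyWord k).rev.realMoebius_pos one_pos)]

/-! ### The weight of the arc from `exp (π i / 3)` to `exp (2 π i / 3)` -/

/-- The point `exp (i t)` of the upper half plane, for `0 < t < π`. -/
noncomputable def arcPoint (t : ℝ) : ℍ := UpperHalfPlane.ofComplex (Complex.exp (t * Complex.I))

theorem im_exp_pos {t : ℝ} (h0 : 0 < t) (hπ : t < Real.pi) :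
    0 < (Complex.exp (t * Complex.I)).im := by
  rw [Complex.exp_ofReal_mul_I_im]
  exact Real.sin_pos_of_pos_of_lt_pi h0 hπ

theorem coe_arcPoint {t : ℝ} (h0 : 0 < t) (hπ : t < Real.pi) :
    (arcPoint t : ℂ) = Complex.exp (t * Complex.I) := by
  rw [arcPoint, UpperHalfPlane.ofComplex_apply_of_im_pos (im_exp_pos h0 hπ)]

/-- The arc, as a set of angles. -/
def arcAngles : Set ℝ := Set.Icc (Real.pi / 3) (2 * Real.pi / 3)

theorem arc_le : Real.pi / 3 ≤ 2 * Real.pi / 3 := by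
  linarith [Real.pi_pos]

theorem uIcc_arc : Set.uIcc (Real.pi / 3) (2 * Real.pi / 3) = arcAngles :=
  Set.uIcc_of_le arc_le

theorem mem_arc_bounds {t : ℝ} (ht : t ∈ arcAngles) : 0 < t ∧ t < Real.pi := by
  have := Real.pi_pos
  constructor <;> linarith [ht.1, ht.2]

theorem cos_two_pi_div_three : Real.cos (2 * Real.pi / 3) = -(1 / 2) := by
  rw [show 2 * Real.pi / 3 = Real.pi - Real.pi / 3 by ring, Real.cos_pi_sub, Real.cos_pi_div_three]

theorem sin_two_pi_div_three : Real.sin (2 * Real.pi / 3) = Real.sqrt 3 / 2 := by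
  rw [show 2 * Real.pi / 3 = Real.pi - Real.pi / 3 by ring, Real.sin_pi_sub, Real.sin_pi_div_three]

theorem abs_cos_le_of_mem_arc {t : ℝ} (ht : t ∈ arcAngles) : |Real.cos t| ≤ 1 / 2 := by
  obtain ⟨h0, hπ⟩ := mem_arc_bounds ht
  have hp := Real.pi_pos
  have h1 := Real.cos_le_cos_of_nonneg_of_le_pi (by positivity) hπ.le ht.1
  have h2 := Real.cos_le_cos_of_nonneg_of_le_pi h0.le (by linarith) ht.2
  rw [Real.cos_pi_div_three] at h1
  rw [cos_two_pi_div_three] at h2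
  exact abs_le.mpr ⟨h2, h1⟩

/-- The kernel `x / |exp (i t) - x| ^ 2`. -/
noncomputable def arcKernel (x t : ℝ) : ℝ := x / (1 - 2 * x * Real.cos t + x ^ 2)

/-- On the arc `cos t ≤ 1 / 2`, and `1 - x + x² = (1 + x)² / 4 + 3 (1 - x)² / 4`. -/
theorem arcKernel_den_ge {x t : ℝ} (hx : 0 < x) (ht : t ∈ arcAngles) :
    (1 + x) ^ 2 / 4 ≤ 1 - 2 * x * Real.cos t + x ^ 2 := by
  have h := (abs_le.mp (abs_cos_le_of_mem_arc ht)).2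
  nlinarith [sq_nonneg (x - 1), mul_le_mul_of_nonneg_left h hx.le]

theorem continuousOn_arcKernel {x : ℝ} (hx : 0 < x) : ContinuousOn (arcKernel x) arcAngles := by
  refine ContinuousOn.div (by fun_prop) (by fun_prop) fun t ht => ?_
  have := arcKernel_den_ge hx ht
  have : 0 < (1 + x) ^ 2 / 4 := by positivity
  linarith

theorem arcKernel_inv {x : ℝ} (hx : 0 < x) (t : ℝ) : arcKernel x⁻¹ t = arcKernel x t := by
  have : 1 - 2 * x⁻¹ * Real.cos t + x⁻¹ ^ 2 = (1 - 2 * x * Real.cos t + x ^ 2) / x ^ 2 := by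
    field_simp
    ring
  rw [arcKernel, this, arcKernel, div_div_eq_mul_div]
  field_simp

theorem abs_arcKernel_le {x t : ℝ} (hx : 0 < x) (ht : t ∈ arcAngles) :
    |arcKernel x t| ≤ 16 * (x / (1 + x)) := by
  have h1 := arcKernel_den_ge hx ht
  have h2 : 0 < (1 + x) ^ 2 / 4 := by positivity
  have h3 : 0 < 1 - 2 * x * Real.cos t + x ^ 2 := h2.trans_le h1
  rw [arcKernel, abs_of_pos (div_pos hx h3), ← mul_div_assoc,
    div_le_div_iff₀ h3 (by positivity)]
  have : (1 + x) ≤ 16 * (1 - 2 * x * Real.cos t + x ^ 2) := by nlinarith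
  nlinarith

theorem abs_arcKernel_sub_le {x y t : ℝ} (hx : 0 < x) (hy : 0 < y) (ht : t ∈ arcAngles) :
    |arcKernel x t - arcKernel y t| ≤ 16 * |x / (1 + x) - y / (1 + y)| := by
  have x1 := arcKernel_den_ge hx ht
  have y1 := arcKernel_den_ge hy ht
  rw [arcKernel, arcKernel]
  set p := 1 - 2 * x * Real.cos t + x ^ 2 with hp
  set q := 1 - 2 * y * Real.cos t + y ^ 2 with hq
  have p0 : 0 < p := lt_of_lt_of_le (by positivity) x1
  have q0 : 0 < q := lt_of_lt_of_le (by positivity) y1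
  have e1 : x / p - y / q = (x - y) * (1 - x * y) / (p * q) := by
    rw [div_sub_div _ _ p0.ne' q0.ne', hp, hq]; ring
  have e2 : x / (1 + x) - y / (1 + y) = (x - y) / ((1 + x) * (1 + y)) := by
    rw [div_sub_div _ _ (by positivity) (by positivity)]; ring
  have s0 : 0 < (1 + x) * (1 + y) := by positivity
  rw [e1, e2, abs_div, abs_div, abs_mul, abs_of_pos (mul_pos p0 q0), abs_of_pos s0,
    ← mul_div_assoc, div_le_div_iff₀ (mul_pos p0 q0) s0]
  -- The constant `16` is the product of the two factors `4` in the lower bounds for the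
  -- denominators `p` and `q`.
  have h1 : |1 - x * y| ≤ (1 + x) * (1 + y) := by
    rw [abs_le]; constructor <;> nlinarith [mul_pos hx hy]
  have h2 : ((1 + x) * (1 + y)) * ((1 + x) * (1 + y)) ≤ 16 * (p * q) := by
    have := mul_le_mul x1 y1 (by positivity) p0.le
    nlinarith
  calc |x - y| * |1 - x * y| * ((1 + x) * (1 + y))
      ≤ |x - y| * ((1 + x) * (1 + y)) * ((1 + x) * (1 + y)) := by gcongr
    _ = |x - y| * (((1 + x) * (1 + y)) * ((1 + x) * (1 + y))) := by ring
    _ ≤ |x - y| * (16 * (p * q)) := by gcongr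
    _ = 16 * |x - y| * (p * q) := by ring

/-- The density `Re f(exp (i t)) sin t`. -/
noncomputable def arcDensity (f : ℍ → ℂ) (t : ℝ) : ℝ := (f (arcPoint t)).re * Real.sin t

/-- The contribution of the arc to a cycle integral with endpoint `x > 0`. -/
noncomputable def arcWeight (f : ℍ → ℂ) (x : ℝ) : ℝ :=
  ∫ t in (Real.pi / 3)..(2 * Real.pi / 3), arcDensity f t * arcKernel x t

theorem continuousOn_arcDensity {f : ℍ → ℂ} (hf : IsWeaklyHolomorphicModularFunction f) :
    ContinuousOn (arcDensity f) arcAngles := by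
  have h1 : DifferentiableOn ℂ (f ∘ UpperHalfPlane.ofComplex) {z | 0 < z.im} :=
    UpperHalfPlane.mdifferentiable_iff.mp hf.holomorphic
  have h2 : ContinuousOn (fun t : ℝ => f (arcPoint t)) arcAngles :=
    h1.continuousOn.comp (f := fun t : ℝ => Complex.exp (t * Complex.I)) (by fun_prop)
      fun t ht => im_exp_pos (mem_arc_bounds ht).1 (mem_arc_bounds ht).2
  exact (Complex.continuous_re.comp_continuousOn h2).mul Real.continuous_sin.continuousOn

theorem intervalIntegrable_arc {g : ℝ → ℝ} (hg : ContinuousOn g arcAngles) :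
    IntervalIntegrable g MeasureTheory.volume (Real.pi / 3) (2 * Real.pi / 3) :=
  ContinuousOn.intervalIntegrable (uIcc_arc ▸ hg)

theorem abs_arc_integral_le {d g : ℝ → ℝ} {M : ℝ} (hd : ContinuousOn d arcAngles)
    (hg : ContinuousOn g arcAngles) (hM : ∀ t ∈ arcAngles, |g t| ≤ M) :
    |∫ t in (Real.pi / 3)..(2 * Real.pi / 3), d t * g t|
      ≤ (∫ t in (Real.pi / 3)..(2 * Real.pi / 3), |d t|) * M := by
  rw [← intervalIntegral.integral_mul_const]
  refine (intervalIntegral.abs_integral_le_integral_abs arc_le).trans ?_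
  refine intervalIntegral.integral_mono_on arc_le (intervalIntegrable_arc (hd.mul hg).abs)
    (intervalIntegrable_arc (hd.abs.mul continuousOn_const)) fun t ht => ?_
  rw [abs_mul]
  exact mul_le_mul_of_nonneg_left (hM t ht) (abs_nonneg _)

theorem isTreeWeight_arcWeight {f : ℍ → ℂ} (hf : IsWeaklyHolomorphicModularFunction f) :
    IsTreeWeight (arcWeight f)
      ((∫ t in (Real.pi / 3)..(2 * Real.pi / 3), |arcDensity f t|) * 16) where
  inv x hx := by simp only [arcWeight, arcKernel_inv hx]
  abs_le x hx := by
    rw [mul_assoc]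
    exact abs_arc_integral_le (continuousOn_arcDensity hf) (continuousOn_arcKernel hx)
      fun t ht => abs_arcKernel_le hx ht
  abs_sub_le x y hx hy := by
    have hd := continuousOn_arcDensity hf
    have e : arcWeight f x - arcWeight f y = ∫ t in (Real.pi / 3)..(2 * Real.pi / 3),
        arcDensity f t * (arcKernel x t - arcKernel y t) := by
      simp only [mul_sub]
      exact (intervalIntegral.integral_sub
        (intervalIntegrable_arc (hd.mul (continuousOn_arcKernel hx)))
        (intervalIntegrable_arc (hd.mul (continuousOn_arcKernel hy)))).symm
    rw [mul_assoc, e]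
    exact abs_arc_integral_le hd ((continuousOn_arcKernel hx).sub (continuousOn_arcKernel hy))
      fun t ht => abs_arcKernel_sub_le hx hy ht

/-- `S : τ ↦ -1 / τ` reflects the arc in the imaginary axis and leaves `f` invariant. -/
theorem arcDensity_pi_sub {f : ℍ → ℂ} (hf : IsWeaklyHolomorphicModularFunction f) {t : ℝ}
    (ht : t ∈ arcAngles) : arcDensity f (Real.pi - t) = arcDensity f t := by
  obtain ⟨h0, hπ⟩ := mem_arc_bounds ht
  have h : arcPoint (Real.pi - t) = ModularGroup.S • arcPoint t := by
    apply UpperHalfPlane.ext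
    rw [UpperHalfPlane.modular_S_smul, coe_arcPoint (by linarith) (by linarith)]
    change _ = (-(arcPoint t : ℂ))⁻¹
    rw [coe_arcPoint h0 hπ, inv_neg, ← Complex.exp_neg]
    push_cast
    rw [sub_mul, sub_eq_add_neg, Complex.exp_add, Complex.exp_pi_mul_I]
    ring
  rw [arcDensity, arcDensity, h, hf.invariant, Real.sin_pi_sub]

/-- A negative fixed point `-x` produces the kernel at the reflected angle; by this symmetry it
carries the same weight as the positive point `x`. -/
theorem arcWeight_eq_reflected {f : ℍ → ℂ} (hf : IsWeaklyHolomorphicModularFunction f) (x : ℝ) :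
    arcWeight f x
      = ∫ t in (Real.pi / 3)..(2 * Real.pi / 3), arcDensity f t * arcKernel x (Real.pi - t) := by
  have h := intervalIntegral.integral_comp_sub_left (a := Real.pi / 3) (b := 2 * Real.pi / 3)
    (fun t => arcDensity f t * arcKernel x t) Real.pi
  rw [show Real.pi - 2 * Real.pi / 3 = Real.pi / 3 by ring,
    show Real.pi - Real.pi / 3 = 2 * Real.pi / 3 by ring] at h
  rw [arcWeight, ← h]
  refine intervalIntegral.integral_congr fun t ht => ?_
  rw [uIcc_arc] at ht
  simp only [arcDensity_pi_sub hf ht]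

theorem coe_smul_eq (A : SL(2, ℤ)) (τ : ℍ) :
    ((A • τ : ℍ) : ℂ) = ((A 0 0 : ℂ) * τ + A 0 1) / ((A 1 0 : ℂ) * τ + A 1 1) := by
  rw [UpperHalfPlane.coe_specialLinearGroup_apply]
  simp

/-- Both `T` and `V` map the left end of the arc to its right end. -/
theorem smul_arc_end {W : SL(2, ℤ)} (hW : W = matV ∨ W = matT) :
    W • arcPoint (2 * Real.pi / 3) = arcPoint (Real.pi / 3) := by
  have hp := Real.pi_pos
  have h1 : (arcPoint (Real.pi / 3) : ℂ) = 1 / 2 + (Real.sqrt 3 / 2 : ℝ) * Complex.I := by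
    rw [coe_arcPoint (by linarith) (by linarith), Complex.exp_mul_I, ← Complex.ofReal_cos,
      ← Complex.ofReal_sin, Real.cos_pi_div_three, Real.sin_pi_div_three]
    push_cast; ring
  have h2 : (arcPoint (2 * Real.pi / 3) : ℂ) = -(1 / 2) + (Real.sqrt 3 / 2 : ℝ) * Complex.I := by
    rw [coe_arcPoint (by linarith) (by linarith), Complex.exp_mul_I, ← Complex.ofReal_cos,
      ← Complex.ofReal_sin, cos_two_pi_div_three, sin_two_pi_div_three]
    push_cast; ring
  have h3 : ((Real.sqrt 3 / 2 : ℝ) : ℂ) ^ 2 = 3 / 4 := by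
    rw [← Complex.ofReal_pow, div_pow, Real.sq_sqrt (by norm_num)]; norm_num
  apply UpperHalfPlane.ext
  rw [coe_smul_eq, h1, h2]
  generalize ((Real.sqrt 3 / 2 : ℝ) : ℂ) = s at h3 ⊢
  rcases hW with rfl | rfl
  · have h4 : -(1 / 2) + s * Complex.I + 1 ≠ 0 := by
      intro h
      have : (-(1 / 2) + s * Complex.I + 1) * (1 / 2 - s * Complex.I) = 1 := by
        linear_combination h3 - s ^ 2 * Complex.I_sq
      rw [h, zero_mul] at this
      exact zero_ne_one this
    simp only [show matV 0 0 = 1 from rfl, show matV 0 1 = 0 from rfl, show matV 1 0 = 1 from rfl,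
      show matV 1 1 = 1 from rfl, Int.cast_one, Int.cast_zero, one_mul, add_zero]
    rw [div_eq_iff h4]
    linear_combination (-1 : ℂ) * h3 * Complex.I ^ 2 - 3 / 4 * Complex.I_sq
  · simp only [show matT 0 0 = 1 from rfl, show matT 0 1 = 1 from rfl, show matT 1 0 = 0 from rfl,
      show matT 1 1 = 1 from rfl, Int.cast_one, Int.cast_zero, one_mul, zero_mul, zero_add, div_one]
    ring

/-! ### Cycle integrals along the tree -/

/-- The quadratic polynomial `c z ^ 2 + (d - a) z - b`, whose roots are the fixed points of
`A = (a, b; c, d)`. -/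
def fixQuad (A : SL(2, ℤ)) (z : ℂ) : ℂ :=
  (A 1 0 : ℂ) * z ^ 2 + ((A 1 1 : ℂ) - A 0 0) * z - A 0 1

/-- The square root of the discriminant of `A`. -/
noncomputable def rootDisc (A : SL(2, ℤ)) : ℝ := Real.sqrt (((A 0 0 : ℝ) + A 1 1) ^ 2 - 4)

/-- The content cancels between `√D` and `Q`, so the form may be taken straight from the entries of
`A`. This form behaves well under conjugation. -/
theorem cycleIntegrand_eq {f : ℍ → ℂ} {A : SL(2, ℤ)}
    (h : (A : Matrix (Fin 2) (Fin 2) ℤ).IsHyperbolic) (htr : 0 < A 0 0 + A 1 1) (z : ℂ) :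
    cycleIntegrand f A z = f (UpperHalfPlane.ofComplex z) * (rootDisc A / -fixQuad A z) := by
  obtain ⟨h1, h2, h3⟩ := cycleForm_mul_content A
  have hg : (content A : ℂ) ≠ 0 := by exact_mod_cast (content_spec h).2.1
  rw [Int.sign_eq_one_of_pos htr] at h1 h2 h3
  have h1C : ((cycleForm A).1 : ℂ) * content A = -1 * A 1 0 := by exact_mod_cast h1
  have h2C : ((cycleForm A).2.1 : ℂ) * content A = -1 * (A 1 1 - A 0 0) := by exact_mod_cast h2
  have h3C : ((cycleForm A).2.2 : ℂ) * content A = 1 * A 0 1 := by exact_mod_cast h3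
  have hq : cycleQuad A z * content A = -fixQuad A z := by
    rw [cycleQuad, fixQuad]
    linear_combination z ^ 2 * h1C + z * h2C + h3C
  have hD : Real.sqrt (cycleDisc A) * content A = rootDisc A := by
    have h4 : (cycleDisc A : ℝ) * (content A : ℝ) ^ 2 = ((A 0 0 : ℝ) + A 1 1) ^ 2 - 4 := by
      exact_mod_cast cycleDisc_mul h
    rw [rootDisc, ← h4, Real.sqrt_mul' _ (by positivity), Real.sqrt_sq (by positivity)]
  rw [cycleIntegrand, ← hq, ← hD, mul_div_assoc, Complex.ofReal_mul, Complex.ofReal_natCast,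
    mul_div_mul_right _ _ hg]

theorem conj_trace (P B : SL(2, ℤ)) :
    (P * B * P⁻¹) 0 0 + (P * B * P⁻¹) 1 1 = B 0 0 + B 1 1 := by
  have h := Matrix.trace_mul_cycle P.1 B.1 (P⁻¹ : SL(2, ℤ)).1
  rw [← Matrix.SpecialLinearGroup.coe_mul, ← Matrix.SpecialLinearGroup.coe_mul,
    ← Matrix.SpecialLinearGroup.coe_mul, ← Matrix.SpecialLinearGroup.coe_mul,
    inv_mul_cancel, one_mul, Matrix.trace_fin_two, Matrix.trace_fin_two] at h
  exact h

/-- The factor `(c z + d)²` is exactly the one that the derivative of the Möbius map of `P` cancels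
when the integrand is pulled back. -/
theorem fixQuad_conj (P B : SL(2, ℤ)) {z : ℂ} (hz : (P 1 0 : ℂ) * z + P 1 1 ≠ 0) :
    fixQuad (P * B * P⁻¹) (((P 0 0 : ℂ) * z + P 0 1) / ((P 1 0 : ℂ) * z + P 1 1))
      * ((P 1 0 : ℂ) * z + P 1 1) ^ 2 = fixQuad B z := by
  have hdet : (P 0 0 : ℂ) * P 1 1 - P 0 1 * P 1 0 = 1 := by exact_mod_cast det_eq_one P
  obtain ⟨m1, m2, m3, m4⟩ := mul_apply_entries (P * B) P⁻¹
  obtain ⟨n1, n2, n3, n4⟩ := mul_apply_entries P B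
  have i1 : P⁻¹ 0 0 = P 1 1 := by rw [Matrix.SpecialLinearGroup.SL2_inv_expl]; rfl
  have i2 : P⁻¹ 0 1 = -P 0 1 := by rw [Matrix.SpecialLinearGroup.SL2_inv_expl]; rfl
  have i3 : P⁻¹ 1 0 = -P 1 0 := by rw [Matrix.SpecialLinearGroup.SL2_inv_expl]; rfl
  have i4 : P⁻¹ 1 1 = P 0 0 := by rw [Matrix.SpecialLinearGroup.SL2_inv_expl]; rfl
  rw [fixQuad, fixQuad, m1, m2, m3, m4, n1, n2, n3, n4, i1, i2, i3, i4]
  push_cast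
  generalize (P 0 0 : ℂ) = p at *
  generalize (P 0 1 : ℂ) = q at *
  generalize (P 1 0 : ℂ) = r at *
  generalize (P 1 1 : ℂ) = s at *
  generalize (B 0 0 : ℂ) = a at *
  generalize (B 0 1 : ℂ) = b at *
  generalize (B 1 0 : ℂ) = c at *
  generalize (B 1 1 : ℂ) = d at *
  have key : ∀ α β γ n e : ℂ, e ≠ 0 →
      (α * (n / e) ^ 2 + β * (n / e) - γ) * e ^ 2 = α * n ^ 2 + β * (n * e) - γ * e ^ 2 := by
    intro α β γ n e he
    field_simp
  rw [key _ _ _ _ _ hz]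
  -- The two sides differ by the factor `(det P)²`.
  linear_combination ((p * s - q * r) + 1) * (c * z ^ 2 + (d - a) * z - b) * hdet

/-- A hyperbolic word has a positive fixed point, and so has its reversal; they factor
`fixQuad`. -/
theorem IsFareyWord.exists_fixed {n : ℕ} {B : SL(2, ℤ)} (hB : IsFareyWord n B)
    (htr : 2 < B 0 0 + B 1 1) : ∃ u v : ℝ, 0 < u ∧ 0 < v ∧ realMoebius B u = u ∧
      realMoebius (wordRev B) v = v ∧
      ∀ z : ℂ, 0 < z.im → (rootDisc B : ℂ) / -fixQuad B z = 1 / (z + v) - 1 / (z - u) := by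
  have hdet : (B 0 0 : ℝ) * B 1 1 - B 0 1 * B 1 0 = 1 := by exact_mod_cast det_eq_one B
  have hcZ : B 1 0 ≠ 0 ∧ B 0 1 ≠ 0 := by
    have h := det_eq_one B
    obtain ⟨h1, -, -, h4, -⟩ := hB.bounds
    have : 0 < B 0 1 * B 1 0 := by nlinarith
    exact ⟨fun h0 => by simp [h0] at this, fun h0 => by simp [h0] at this⟩
  obtain ⟨r1, r2, r3, r4⟩ := wordRev_apply B
  obtain ⟨a1, b0, c0, d1, -⟩ := hB.bounds_real
  have hb : (0 : ℝ) < B 0 1 := b0.lt_of_ne (by exact_mod_cast hcZ.2.symm)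
  have hc : (0 : ℝ) < B 1 0 := c0.lt_of_ne (by exact_mod_cast hcZ.1.symm)
  have htrR : (2 : ℝ) < B 0 0 + B 1 1 := by exact_mod_cast htr
  have hr2 : rootDisc B ^ 2 = ((B 0 0 : ℝ) + B 1 1) ^ 2 - 4 := Real.sq_sqrt (by nlinarith)
  have hr0 : 0 ≤ rootDisc B := Real.sqrt_nonneg _
  simp only [realMoebius, r1, r2, r3, r4, fixQuad]
  set r := rootDisc B
  have hcast : ∀ m : ℤ, (m : ℂ) = ((m : ℝ) : ℂ) := fun m => by simp
  simp only [hcast]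
  generalize (B 0 0 : ℝ) = a at *
  generalize (B 0 1 : ℝ) = b at *
  generalize (B 1 0 : ℝ) = c at *
  generalize (B 1 1 : ℝ) = d at *
  -- Since the determinant is `1`, `r² - (a - d)² = 4 b c > 0`; this makes `u` and `v` both
  -- positive.
  have hlt : (a - d) ^ 2 < r ^ 2 := by
    rw [hr2]; nlinarith [mul_pos hb hc]
  obtain ⟨hl1, hl2⟩ := abs_lt.mp (abs_lt_of_sq_lt_sq hlt hr0)
  -- The fixed points of `B` are `u` and `-v`. The matrix `wordRev B` is `B⁻¹` conjugated by `z ↦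
  -- -z`, hence it fixes `v`. The last claim is the partial fraction expansion of `c (u + v) / (-c
  -- (z - u) (z + v))`.
  set u := (a - d + r) / (2 * c) with hu
  set v := (d - a + r) / (2 * c) with hv
  have u0 : 0 < u := div_pos (by linarith) (by linarith)
  have v0 : 0 < v := div_pos (by linarith) (by linarith)
  have e1 : c * (u + v) = r := by rw [hu, hv]; field_simp; ring
  have e2 : c * (u - v) = a - d := by rw [hu, hv]; field_simp; ring
  have e3 : c * (u * v) = b := by
    rw [hu, hv]; field_simp; linear_combination hr2 + 4 * hdet
  refine ⟨u, v, u0, v0, ?_, ?_, fun z hz => ?_⟩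
  · rw [div_eq_iff (by positivity)]
    linear_combination -u * e2 - e3
  · rw [div_eq_iff (by positivity)]
    linear_combination v * e2 - e3
  · have hne : ∀ x : ℝ, z - x ≠ 0 := by
      intro x hx
      have := congrArg Complex.im hx
      simp at this
      exact hz.ne' this
    have z1 := hne u
    have z2 : z + v ≠ 0 := by simpa using hne (-v)
    have hcC : (c : ℂ) ≠ 0 := by exact_mod_cast hc.ne'
    have hq : (c : ℂ) * z ^ 2 + ((d : ℂ) - a) * z - b = c * ((z - u) * (z + v)) := by
      have e2C : (c : ℂ) * (u - v) = a - d := by exact_mod_cast e2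
      have e3C : (c : ℂ) * (u * v) = b := by exact_mod_cast e3
      linear_combination z * e2C + e3C
    rw [hq, ← e1]
    push_cast
    field_simp
    ring

/-- The real part of the integrand on the arc. -/
theorem re_arc_integrand {f : ℍ → ℂ} {t u v : ℝ} (ht : t ∈ arcAngles)
    (him : (f (arcPoint t)).im = 0) (hu : 0 < u) (hv : 0 < v) :
    (f (arcPoint t) * (1 / (Complex.exp (t * Complex.I) + v)
      - 1 / (Complex.exp (t * Complex.I) - u)) * (Complex.exp (t * Complex.I) * Complex.I)).re
      = -(arcDensity f t * arcKernel u t + arcDensity f t * arcKernel v (Real.pi - t)) := by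
  have hf : f (arcPoint t) = ((f (arcPoint t)).re : ℂ) :=
    Complex.ext (by simp) (by simpa using him)
  have ht' : Real.pi - t ∈ arcAngles := ⟨by linarith [ht.2], by linarith [ht.1]⟩
  have d1 := arcKernel_den_ge hu ht
  have d2 := arcKernel_den_ge hv ht'
  have d1' : 0 < (1 + u) ^ 2 / 4 := by positivity
  have d2' : 0 < (1 + v) ^ 2 / 4 := by positivity
  rw [Real.cos_pi_sub] at d2
  -- The sign of `x` is left free, so that the formula serves both for `v` and for `-u`.
  have key : ∀ x : ℝ, 0 < 1 + 2 * x * Real.cos t + x ^ 2 →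
      (1 / (Complex.exp (t * Complex.I) + x) * (Complex.exp (t * Complex.I) * Complex.I)).re
        = - (Real.sin t * (x / (1 + 2 * x * Real.cos t + x ^ 2))) := by
    intro x hx
    have hsc := Real.sin_sq_add_cos_sq t
    have hn : Complex.normSq (Complex.exp (t * Complex.I) + x) = 1 + 2 * x * Real.cos t + x ^ 2 := by
      rw [Complex.normSq_apply]
      simp only [Complex.add_re, Complex.add_im, Complex.exp_ofReal_mul_I_re,
        Complex.exp_ofReal_mul_I_im, Complex.ofReal_re, Complex.ofReal_im]
      linear_combination hsc
    rw [one_div, Complex.mul_re, Complex.inv_re, Complex.inv_im, hn]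
    simp only [Complex.add_re, Complex.add_im, Complex.exp_ofReal_mul_I_re,
        Complex.exp_ofReal_mul_I_im, Complex.ofReal_re, Complex.ofReal_im, Complex.mul_re,
        Complex.mul_im, Complex.I_re, Complex.I_im]
    field_simp
    ring
  have k1 := key v (by linarith)
  have k2 := key (-u) (by linarith)
  have e : f (arcPoint t) * (1 / (Complex.exp (t * Complex.I) + v)
      - 1 / (Complex.exp (t * Complex.I) - u)) * (Complex.exp (t * Complex.I) * Complex.I)
      = ((f (arcPoint t)).re : ℂ) *
        ((1 / (Complex.exp (t * Complex.I) + v)) * (Complex.exp (t * Complex.I) * Complex.I)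
        - (1 / (Complex.exp (t * Complex.I) + (-u : ℝ)))
          * (Complex.exp (t * Complex.I) * Complex.I)) := by
    rw [← hf]; push_cast; ring
  rw [e, Complex.re_ofReal_mul, Complex.sub_re, k1, k2, arcDensity, arcKernel, arcKernel,
    Real.cos_pi_sub, show 1 + 2 * -u * Real.cos t + (-u) ^ 2 = 1 - 2 * u * Real.cos t + u ^ 2 by ring,
    show 1 - 2 * v * -Real.cos t + v ^ 2 = 1 + 2 * v * Real.cos t + v ^ 2 by ring]
  ring

/-- The arcs of the tree from `P ρ'` to `P ρ` contribute the weights of the two fixed points of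
the conjugate by `P`. -/
theorem re_primitive_sub {f : ℍ → ℂ} (hf : IsWeaklyHolomorphicModularFunction f)
    (hreal : ∀ t ∈ arcAngles, (f (arcPoint t)).im = 0) {P B : SL(2, ℤ)} {G : ℂ → ℂ}
    (hG : ∀ z : ℂ, 0 < z.im → HasDerivAt G
      (f (UpperHalfPlane.ofComplex z) * (rootDisc (P * B * P⁻¹) / -fixQuad (P * B * P⁻¹) z)) z)
    {u v : ℝ} (hu : 0 < u) (hv : 0 < v)
    (hB : ∀ z : ℂ, 0 < z.im → (rootDisc B : ℂ) / -fixQuad B z = 1 / (z + v) - 1 / (z - u)) :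
    (G (P • arcPoint (Real.pi / 3) : ℍ)).re - (G (P • arcPoint (2 * Real.pi / 3) : ℍ)).re
      = arcWeight f u + arcWeight f v := by
  set m : ℂ → ℂ := fun z => ((P 0 0 : ℂ) * z + P 0 1) / ((P 1 0 : ℂ) * z + P 1 1) with hm
  have hdet : (P 0 0 : ℂ) * P 1 1 - P 0 1 * P 1 0 = 1 := by exact_mod_cast det_eq_one P
  have htr : rootDisc (P * B * P⁻¹) = rootDisc B := by
    have : (((P * B * P⁻¹) 0 0 : ℤ) : ℝ) + ((P * B * P⁻¹) 1 1 : ℤ) = (B 0 0 : ℝ) + B 1 1 := by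
      exact_mod_cast conj_trace P B
    rw [rootDisc, this, rootDisc]
  have hden : ∀ τ : ℍ, (P 1 0 : ℂ) * τ + P 1 1 ≠ 0 := by
    intro τ h0
    have h1 := congrArg Complex.im h0
    simp at h1
    have h2 : P 1 0 = 0 := h1.resolve_right τ.im_ne_zero
    rw [h2] at h0
    simp at h0
    have := det_eq_one P
    rw [h2, h0] at this
    simp at this
  have hder : ∀ t ∈ arcAngles, HasDerivAt (fun t : ℝ => (G (m (Complex.exp (t * Complex.I)))).re)
      (-(arcDensity f t * arcKernel u t + arcDensity f t * arcKernel v (Real.pi - t))) t := by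
    intro t ht
    obtain ⟨h0, hπ⟩ := mem_arc_bounds ht
    have hco := coe_arcPoint h0 hπ
    have him := im_exp_pos h0 hπ
    have hd := hden (arcPoint t)
    rw [hco] at hd
    have hsm : m (Complex.exp (t * Complex.I)) = (P • arcPoint t : ℍ) := by
      rw [coe_smul_eq, hco]
    have hexp : HasDerivAt (fun t : ℝ => Complex.exp (t * Complex.I))
        (Complex.exp (t * Complex.I) * Complex.I) t := by
      have h1 : HasDerivAt (fun t : ℝ => (t : ℂ) * Complex.I) Complex.I t := by
        simpa using (hasDerivAt_id t).ofReal_comp.mul_const Complex.I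
      exact h1.cexp
    have hmder : HasDerivAt m (1 / ((P 1 0 : ℂ) * Complex.exp (t * Complex.I) + P 1 1) ^ 2)
        (Complex.exp (t * Complex.I)) := by
      generalize Complex.exp (t * Complex.I) = z at *
      have h1 : HasDerivAt (fun z : ℂ => (P 0 0 : ℂ) * z + P 0 1) (P 0 0 : ℂ) z := by
        simpa using ((hasDerivAt_id z).const_mul (P 0 0 : ℂ)).add_const (P 0 1 : ℂ)
      have h2 : HasDerivAt (fun z : ℂ => (P 1 0 : ℂ) * z + P 1 1) (P 1 0 : ℂ) z := by
        simpa using ((hasDerivAt_id z).const_mul (P 1 0 : ℂ)).add_const (P 1 1 : ℂ)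
      have h3 : ((P 0 0 : ℂ) * ((P 1 0 : ℂ) * z + P 1 1) - ((P 0 0 : ℂ) * z + P 0 1) * (P 1 0 : ℂ))
          = 1 := by linear_combination hdet
      have h4 := h1.div h2 hd
      rw [h3] at h4
      exact h4
    have hGm := hG (m (Complex.exp (t * Complex.I))) (by rw [hsm]; exact (P • arcPoint t).im_pos)
    have hcomp := (hGm.comp _ hmder).comp_of_eq t hexp rfl
    have hre := Complex.reCLM.hasFDerivAt.comp_hasDerivAt t hcomp
    refine hre.congr_deriv ?_
    rw [← re_arc_integrand ht (hreal t ht) hu hv, Complex.reCLM_apply]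
    congr 1
    rw [show UpperHalfPlane.ofComplex (m (Complex.exp (t * Complex.I))) = P • arcPoint t by
      rw [hsm, UpperHalfPlane.ofComplex_apply], hf.invariant, htr, ← hB _ him,
      ← fixQuad_conj P B hd]
    congr 1
    rw [mul_assoc]
    congr 1
    simp only [hm]
    field_simp
  have hdens := continuousOn_arcDensity hf
  have hrefl : ContinuousOn (fun t => arcKernel v (Real.pi - t)) arcAngles :=
    (continuousOn_arcKernel hv).comp (by fun_prop)
      fun t ht => ⟨by linarith [ht.2], by linarith [ht.1]⟩
  have i1 := intervalIntegrable_arc (hdens.mul (continuousOn_arcKernel hu))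
  have i2 := intervalIntegrable_arc (hdens.mul hrefl)
  -- The path runs from angle `2π/3` down to `π/3`, against the direction of integration; this
  -- absorbs the minus sign of the derivative.
  have hint := intervalIntegral.integral_eq_sub_of_hasDerivAt
    (fun t ht => hder t (uIcc_arc ▸ ht)) (i1.add i2).neg
  rw [intervalIntegral.integral_neg] at hint
  have hsum := intervalIntegral.integral_add i1 i2
  have hw := arcWeight_eq_reflected hf v
  have hp := Real.pi_pos
  rw [coe_smul_eq, coe_smul_eq, coe_arcPoint (by linarith) (by linarith),
    coe_arcPoint (by linarith) (by linarith)]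
  simp only [hm, Pi.mul_apply] at hint hsum
  rw [hw, arcWeight]
  linarith

/-- A primitive on the convex half plane makes the integral additive along any chain of points, so
arcs may replace the segment of the definition. -/
theorem exists_primitive {f : ℍ → ℂ} (hf : IsWeaklyHolomorphicModularFunction f) {A : SL(2, ℤ)}
    (h : (A : Matrix (Fin 2) (Fin 2) ℤ).IsHyperbolic) :
    ∃ G : ℂ → ℂ, (∀ z : ℂ, 0 < z.im → HasDerivAt G (cycleIntegrand f A z) z) ∧
      ∀ τ : ℍ, cycleIntegral f A = G ((A • τ : ℍ) : ℂ) - G τ := by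
  have hconv : Convex ℝ {z : ℂ | 0 < z.im} := convex_halfSpace_im_gt 0
  have hopen : IsOpen {z : ℂ | 0 < z.im} := isOpen_lt continuous_const Complex.continuous_im
  have hdiff := differentiableOn_cycleIntegrand hf h
  obtain ⟨G, hG'⟩ := hconv.exists_forall_hasDerivWithinAt hdiff
  have hG : ∀ z : ℂ, 0 < z.im → HasDerivAt G (cycleIntegrand f A z) z := fun z hz =>
    (hG' z hz).hasDerivAt (hopen.mem_nhds hz)
  refine ⟨G, hG, fun τ => ?_⟩
  rw [cycleIntegral_eq_cycleIntegralFrom hf h τ]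
  set d : ℂ := ((A • τ : ℍ) : ℂ) - τ with hd
  have hmem : ∀ s ∈ Set.uIcc (0 : ℝ) 1, (τ : ℂ) + s * d ∈ {z : ℂ | 0 < z.im} := by
    intro s hs
    rw [Set.uIcc_of_le zero_le_one] at hs
    have := hconv.add_smul_sub_mem (x := (τ : ℂ)) (y := ((A • τ : ℍ) : ℂ)) τ.im_pos
      (A • τ).im_pos hs
    simpa [hd] using this
  have hline : ∀ s : ℝ, HasDerivAt (fun s : ℝ => (τ : ℂ) + s * d) d s := by
    intro s
    simpa using ((hasDerivAt_id s).ofReal_comp.mul_const d).const_add (τ : ℂ)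
  have := intervalIntegral.integral_eq_sub_of_hasDerivAt
    (f := fun s : ℝ => G ((τ : ℂ) + s * d))
    (f' := fun s : ℝ => cycleIntegrand f A ((τ : ℂ) + s * d) * d) (a := 0) (b := 1)
    (fun s hs => HasDerivAt.comp_of_eq s (hG _ (hmem s hs)) (hline s) rfl)
    (by
      apply ContinuousOn.intervalIntegrable
      apply ContinuousOn.mul _ continuousOn_const
      exact hdiff.continuousOn.comp (by fun_prop) hmem)
  rw [cycleIntegralFrom, ← hd, this]
  simp [hd]

/-- The telescoping sum over the points `A k • ρ` expresses the real part exactly through the fixed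
points of the conjugates `(A k)⁻¹ * A n * A k`; the error arises only when these are replaced by
images of `1`. -/
theorem abs_re_cycleIntegral_sub_treeSum_le {f : ℍ → ℂ}
    (hf : IsWeaklyHolomorphicModularFunction f)
    (hreal : ∀ t ∈ arcAngles, (f (arcPoint t)).im = 0) {C : ℝ}
    (hC : IsTreeWeight (arcWeight f) C) {A : ℕ → SL(2, ℤ)} (hA : IsWordPath A) {n : ℕ}
    (hn : (A n : Matrix (Fin 2) (Fin 2) ℤ).IsHyperbolic) :
    |(cycleIntegral f (A n)).re - treeSum (arcWeight f) A n| ≤ 2 * C * harmonicSum n := by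
  have htr : 2 < A n 0 0 + A n 1 1 := by
    obtain ⟨h1, -, -, h4, -⟩ := (hA.isFareyWord n).bounds
    have := (content_spec hn).2.2
    nlinarith
  obtain ⟨G, hG, hGA⟩ := exists_primitive hf hn
  have hconj : ∀ k, A k * ((A k)⁻¹ * A n * A k) * (A k)⁻¹ = A n := fun k => by group
  have hword : ∀ k, k < n → IsFareyWord (n - k + k) ((A k)⁻¹ * A n * A k) := fun k hk =>
    (hA.isFareyWord_tail hk.le).mul (hA.isFareyWord k)
  have hfix : ∀ k, ∃ u v : ℝ, k < n → 0 < u ∧ 0 < v ∧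
      realMoebius ((A k)⁻¹ * A n * A k) u = u ∧
      realMoebius (wordRev ((A k)⁻¹ * A n * A k)) v = v ∧
      ∀ z : ℂ, 0 < z.im → (rootDisc ((A k)⁻¹ * A n * A k) : ℂ) / -fixQuad ((A k)⁻¹ * A n * A k) z
        = 1 / (z + v) - 1 / (z - u) := by
    intro k
    by_cases hk : k < n
    · have : 2 < ((A k)⁻¹ * A n * A k) 0 0 + ((A k)⁻¹ * A n * A k) 1 1 := by
        rw [← conj_trace (A k), hconj]; exact htr
      obtain ⟨u, v, h⟩ := (hword k hk).exists_fixed this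
      exact ⟨u, v, fun _ => h⟩
    -- Dummy values for `k ≥ n`, so that `u` and `v` can be chosen as functions on all of `ℕ`.
    · exact ⟨0, 0, fun h => absurd h hk⟩
  choose u v huv using hfix
  have hsum : (cycleIntegral f (A n)).re
      = ∑ k ∈ Finset.range n, (arcWeight f (u k) + arcWeight f (v k)) := by
    set ρ := arcPoint (2 * Real.pi / 3)
    have htel := Finset.sum_range_sub (fun k => (G (A k • ρ : ℍ)).re) n
    rw [hA.1, one_smul] at htel
    rw [hGA ρ, Complex.sub_re, ← htel]
    refine Finset.sum_congr rfl fun k hk => ?_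
    obtain ⟨h1, h2, -, -, h5⟩ := huv k (Finset.mem_range.mp hk)
    rw [← re_primitive_sub hf hreal (P := A k) (B := (A k)⁻¹ * A n * A k) (G := G) ?_ h1 h2 h5]
    · congr 4
      rcases hA.2 k with h | h <;> rw [h, mul_smul, smul_arc_end]
      exacts [Or.inl rfl, Or.inr rfl]
    · intro z hz
      rw [hconj, ← cycleIntegrand_eq hn (by linarith)]
      exact hG z hz
  rw [hsum]
  refine abs_sum_sub_treeSum_le hC hA n (fun k hk => ?_) fun k hk => ?_
  · obtain ⟨h1, -, h3, -, -⟩ := huv k hk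
    -- As `u k` is fixed by the product of `(A k)⁻¹ * A n` and `A k`, it is the image under the
    -- first factor of its own image under the second. The same applies to `v k`, with the reversed
    -- factors in the opposite order.
    refine ⟨realMoebius (A k) (u k), (hA.isFareyWord k).realMoebius_pos h1, ?_⟩
    rw [← (hA.isFareyWord_tail hk.le).realMoebius_mul (hA.isFareyWord k) h1, h3]
  · obtain ⟨-, h2, -, h4, -⟩ := huv k hk
    have hr := (hA.isFareyWord_tail hk.le).rev
    refine ⟨realMoebius (wordRev ((A k)⁻¹ * A n)) (v k), hr.realMoebius_pos h2, ?_⟩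
    rw [← (hA.isFareyWord k).rev.realMoebius_mul hr h2, ← wordRev_mul, h4]

/-! ### The exponent of a path -/

theorem limsup_coe_congr_of_tendsto_sub {u v : ℕ → ℝ}
    (h : Filter.Tendsto (fun n => u n - v n) Filter.atTop (𝓝 0)) :
    Filter.limsup (fun n => (u n : EReal)) Filter.atTop
      = Filter.limsup (fun n => (v n : EReal)) Filter.atTop := by
  have key : ∀ u v : ℕ → ℝ, Filter.Tendsto (fun n => u n - v n) Filter.atTop (𝓝 0) →
      Filter.limsup (fun n => (u n : EReal)) Filter.atTop
        ≤ Filter.limsup (fun n => (v n : EReal)) Filter.atTop := by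
    intro u v h
    have h0 : Filter.limsup (fun n => ((u n - v n : ℝ) : EReal)) Filter.atTop = 0 :=
      ((continuous_coe_real_ereal.tendsto 0).comp h).limsup_eq
    have h1 := EReal.limsup_add_le (f := Filter.atTop) (u := fun n => (v n : EReal))
      (v := fun n => ((u n - v n : ℝ) : EReal)) (Or.inr (by rw [h0]; exact EReal.zero_ne_top))
      (Or.inr (by rw [h0]; exact EReal.zero_ne_bot))
    rw [h0, add_zero] at h1
    refine le_trans (le_of_eq ?_) h1
    congr 1
    funext n
    rw [Pi.add_apply, ← EReal.coe_add]
    congr 1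
    ring
  refine le_antisymm (key u v h) (key v u ?_)
  have := h.neg
  simpa using this

/-- The limit superior of the normalized tree sums. -/
noncomputable def treeExponent (h : ℝ → ℝ) (A : ℕ → SL(2, ℤ)) : EReal :=
  Filter.limsup (fun n : ℕ => ((treeSum h A n / n : ℝ) : EReal)) Filter.atTop

theorem treeExponent_ne {h : ℝ → ℝ} {C : ℝ} (hh : IsTreeWeight h C) {A : ℕ → SL(2, ℤ)}
    (hA : IsWordPath A) : treeExponent h A ≠ ⊥ ∧ treeExponent h A ≠ ⊤ := by
  have hb : ∀ n : ℕ, |treeSum h A n / n| ≤ 2 * C := by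
    intro n
    rw [abs_div, Nat.abs_cast]
    exact div_le_of_le_mul₀ (Nat.cast_nonneg n) (by linarith [hh.nonneg]) (abs_treeSum_le hh hA n)
  have h1 : ((-(2 * C) : ℝ) : EReal) ≤ treeExponent h A :=
    Filter.le_limsup_of_frequently_le (Filter.Frequently.of_forall fun n =>
      EReal.coe_le_coe_iff.mpr (abs_le.mp (hb n)).1)
  have h2 : treeExponent h A ≤ ((2 * C : ℝ) : EReal) :=
    Filter.limsup_le_of_le (h := Filter.Eventually.of_forall fun n =>
      EReal.coe_le_coe_iff.mpr (abs_le.mp (hb n)).2)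
  exact ⟨((EReal.bot_lt_coe _).trans_le h1).ne', (h2.trans_lt (EReal.coe_lt_top _)).ne⟩

theorem treeExponent_cons {h : ℝ → ℝ} {C : ℝ} (hh : IsTreeWeight h C) {A A' : ℕ → SL(2, ℤ)}
    (hA : IsWordPath A) (hA' : IsWordPath A') {W : SL(2, ℤ)} (hW : IsFareyWord 1 W)
    (hcons : ∀ n, A' (n + 1) = W * A n) : treeExponent h A' = treeExponent h A := by
  rw [treeExponent, ← Filter.limsup_nat_add _ 1, treeExponent]
  apply limsup_coe_congr_of_tendsto_sub
  -- Of the `4 * C`, one half comes from the extra vertex and the other half from dividing by `n +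
  -- 1` instead of `n`.
  have hlim : Filter.Tendsto (fun n : ℕ => 4 * C / n + C * (harmonicSum n / n)) Filter.atTop
      (𝓝 0) := by
    simpa using (tendsto_const_div_atTop_nhds_zero_nat (4 * C)).add
      (tendsto_harmonicSum_div.const_mul C)
  refine squeeze_zero_norm' ?_ hlim
  filter_upwards [Filter.eventually_gt_atTop 0] with n hn
  have hn' : (0 : ℝ) < n := by exact_mod_cast hn
  have h1 := abs_treeSum_cons_sub_le hh hA hA' hW hcons n
  have h2 := abs_treeSum_le hh hA n
  have hH : 0 ≤ harmonicSum n := Finset.sum_nonneg fun k _ => by positivity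
  have hC := hh.nonneg
  have e : treeSum h A' (n + 1) / ((n + 1 : ℕ) : ℝ) - treeSum h A n / n
      = (treeSum h A' (n + 1) - treeSum h A n) / (n + 1) + -(treeSum h A n / (n * (n + 1))) := by
    push_cast
    field_simp
    ring
  rw [Real.norm_eq_abs, e]
  refine (abs_add_le _ _).trans ?_
  rw [abs_neg, abs_div, abs_div, abs_of_pos (show (0 : ℝ) < n + 1 by positivity),
    abs_of_pos (show (0 : ℝ) < n * (n + 1) by positivity)]
  have b1 : |treeSum h A' (n + 1) - treeSum h A n| / (n + 1) ≤ (2 * C + C * harmonicSum n) / n :=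
    div_le_div₀ (by positivity) h1 hn' (by linarith)
  have b2 : |treeSum h A n| / (n * (n + 1)) ≤ (2 * C) / n := by
    rw [div_le_div_iff₀ (by positivity) hn']
    calc |treeSum h A n| * n ≤ (2 * C * n) * n := by gcongr
      _ ≤ 2 * C * (n * (n + 1)) := by nlinarith [mul_nonneg hC hn'.le]
  calc _ ≤ (2 * C + C * harmonicSum n) / n + (2 * C) / n := add_le_add b1 b2
    _ = _ := by ring

/-! ### Farey paths -/

theorem fareyPath_succ_eq (x : ℝ) (n : ℕ) :
    (lowerGap x (fareyPath x n) < upperGap x (fareyPath x n) →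
      fareyPath x (n + 1) = fareyPath x n * matV) ∧
    (¬ lowerGap x (fareyPath x n) < upperGap x (fareyPath x n) →
      fareyPath x (n + 1) = fareyPath x n * matT) := by
  have hrow := bottom_row (A := fareyPath x) rfl (fareyPath_succ x) n
  rw [← lt_fareyFraction_iff hrow, fareyPath]
  exact ⟨fun h => if_pos h, fun h => if_neg h⟩

/-- Each step of a path is decided by comparing the two gaps, and a common positive factor `s` does
not affect the comparison. After the letter `W`, the path of `y` therefore copies that of `x`. -/
theorem fareyPath_cons {x y s : ℝ} {W : SL(2, ℤ)} (hs : 0 < s) (h0 : fareyPath y 1 = W)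
    (hu : ∀ A, s * upperGap y (W * A) = upperGap x A)
    (hl : ∀ A, s * lowerGap y (W * A) = lowerGap x A) (n : ℕ) :
    fareyPath y (n + 1) = W * fareyPath x n := by
  induction n with
  | zero => rw [h0, fareyPath, mul_one]
  | succ n ih =>
    have hiff : lowerGap y (fareyPath y (n + 1)) < upperGap y (fareyPath y (n + 1)) ↔
        lowerGap x (fareyPath x n) < upperGap x (fareyPath x n) := by
      rw [ih, ← hu, ← hl, mul_lt_mul_iff_right₀ hs]
    by_cases h : lowerGap x (fareyPath x n) < upperGap x (fareyPath x n)
    · rw [(fareyPath_succ_eq y (n + 1)).1 (hiff.mpr h), (fareyPath_succ_eq x n).1 h, ih, mul_assoc]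
    · rw [(fareyPath_succ_eq y (n + 1)).2 (mt hiff.mp h), (fareyPath_succ_eq x n).2 h, ih,
        mul_assoc]

theorem fareyPath_add_one {x : ℝ} (hx : 0 ≤ x) (n : ℕ) :
    fareyPath (x + 1) (n + 1) = matT * fareyPath x n := by
  refine fareyPath_cons one_pos ?_ (fun A => ?_) (fun A => ?_) n
  · rw [(fareyPath_succ_eq (x + 1) 0).2, fareyPath, one_mul]
    simp [fareyPath, lowerGap, upperGap, hx]
  all_goals
    obtain ⟨m1, m2, m3, m4⟩ := mul_apply_entries matT A
    simp only [upperGap, lowerGap, m1, m2, m3, m4, show matT 0 0 = 1 from rfl,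
      show matT 0 1 = 1 from rfl, show matT 1 0 = 0 from rfl, show matT 1 1 = 1 from rfl]
    push_cast
    ring

theorem fareyPath_div_one_add {x : ℝ} (hx : 0 ≤ x) (n : ℕ) :
    fareyPath (x / (1 + x)) (n + 1) = matV * fareyPath x n := by
  have hx1 : 0 < 1 + x := by linarith
  refine fareyPath_cons hx1 ?_ (fun A => ?_) (fun A => ?_) n
  · rw [(fareyPath_succ_eq (x / (1 + x)) 0).1, fareyPath, one_mul]
    simp only [fareyPath, lowerGap, upperGap]
    simp [div_lt_one hx1]
  all_goals
    obtain ⟨m1, m2, m3, m4⟩ := mul_apply_entries matV A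
    simp only [upperGap, lowerGap, m1, m2, m3, m4, show matV 0 0 = 1 from rfl,
      show matV 0 1 = 0 from rfl, show matV 1 0 = 1 from rfl, show matV 1 1 = 1 from rfl]
    push_cast
    field_simp
    ring

/-- Inversion exchanges the two gaps up to the factor `x`. Irrationality excludes equal gaps, where
the rule chooses `T` and the symmetry fails. -/
theorem fareyPath_inv {x : ℝ} (hx : 0 < x) (hirr : Irrational x) (n : ℕ) :
    fareyPath x⁻¹ n = wordFlip (fareyPath x n) := by
  induction n with
  | zero => rw [fareyPath, fareyPath, wordFlip_one]
  | succ n ih =>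
    set A := fareyPath x n with hA
    obtain ⟨f1, f2, f3, f4⟩ := wordFlip_apply A
    have hu : x * upperGap x⁻¹ (wordFlip A) = lowerGap x A := by
      rw [upperGap, lowerGap, f1, f3]; field_simp
    have hl : x * lowerGap x⁻¹ (wordFlip A) = upperGap x A := by
      rw [upperGap, lowerGap, f2, f4]; field_simp
    have hne : lowerGap x A ≠ upperGap x A := by
      intro h
      obtain ⟨h1, h2⟩ := fareyFraction_eq
        (bottom_row (A := fareyPath x) rfl (fareyPath_succ x) n) x
      rw [← hA, h, sub_self, zero_div, sub_eq_zero] at h2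
      exact hirr ⟨_, h2⟩
    have hiff : lowerGap x⁻¹ (wordFlip A) < upperGap x⁻¹ (wordFlip A) ↔
        upperGap x A < lowerGap x A := by
      rw [← hu, ← hl, mul_lt_mul_iff_right₀ hx]
    have s1 := fareyPath_succ_eq x⁻¹ n
    have s2 := fareyPath_succ_eq x n
    rw [ih] at s1
    rw [← hA] at s2
    rcases hne.lt_or_gt with h | h
    · rw [s1.2 (by rw [hiff]; exact h.not_gt), s2.1 h, wordFlip_mul, wordFlip_matV]
    · rw [s1.1 (hiff.mpr h), s2.2 h.not_gt, wordFlip_mul, wordFlip_matT]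

/-! ### The path of `0`, that is, the powers of `V` -/

theorem fareyPath_zero_entries (n : ℕ) :
    fareyPath 0 n 0 0 = 1 ∧ fareyPath 0 n 0 1 = 0 := by
  induction n with
  | zero => simp [fareyPath]
  | succ n ih =>
    obtain ⟨v1, v2, -, -⟩ := mul_matV_apply (fareyPath 0 n)
    rw [(fareyPath_succ_eq 0 n).1 (by simp [lowerGap, upperGap, ih.1, ih.2]), v1, v2, ih.1, ih.2]
    simp

/-- Such a word is `(1, 0; c, 1)` with `c ≥ n`. It sends `1` to `1 / (c + 1)`, close to the zero of
`h` at `0`. -/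
theorem IsTreeWeight.abs_word_le {h : ℝ → ℝ} {C : ℝ} (hh : IsTreeWeight h C) {n : ℕ}
    {A : SL(2, ℤ)} (hA : IsFareyWord n A) (h0 : A 0 1 = 0) :
    |h (realMoebius A 1)| ≤ C * (1 / (n + 1)) := by
  refine (hh.abs_le _ (hA.realMoebius_pos one_pos)).trans
    (mul_le_mul_of_nonneg_left ?_ hh.nonneg)
  have had : A 0 0 * A 1 1 = 1 := by simpa [h0] using det_eq_one A
  obtain ⟨b1, b2, b3, b4, b5⟩ := hA.bounds_real
  obtain ⟨z1, -, -, z4, -⟩ := hA.bounds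
  have ha : A 0 0 = 1 := by nlinarith
  have hd : A 1 1 = 1 := by nlinarith
  have e : realMoebius A 1 / (1 + realMoebius A 1) = 1 / ((A 1 0 : ℝ) + 2) := by
    rw [realMoebius, ha, hd, h0]
    push_cast
    field_simp
    ring
  rw [ha, hd, h0] at b5
  push_cast at b5
  rw [e]
  exact one_div_le_one_div_of_le (by positivity) (by linarith)

theorem treeExponent_fareyPath_zero {h : ℝ → ℝ} {C : ℝ} (hh : IsTreeWeight h C) :
    treeExponent h (fareyPath 0) = 0 := by
  have hA := isWordPath_fareyPath 0
  have hlim : Filter.Tendsto (fun n : ℕ => 2 * C * (harmonicSum n / n)) Filter.atTop (𝓝 0) := by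
    simpa using tendsto_harmonicSum_div.const_mul (2 * C)
  have h0 : Filter.Tendsto (fun n : ℕ => treeSum h (fareyPath 0) n / n) Filter.atTop (𝓝 0) := by
    refine squeeze_zero_norm (fun n => ?_) hlim
    rw [Real.norm_eq_abs, abs_div, Nat.abs_cast, ← mul_div_assoc]
    refine div_le_div_of_nonneg_right ?_ (Nat.cast_nonneg n)
    refine (Finset.abs_sum_le_sum_abs _ _).trans ?_
    have key : ∀ k ∈ Finset.range n, |h (realMoebius ((fareyPath 0 k)⁻¹ * fareyPath 0 n) 1)
        + h (realMoebius (wordRev (fareyPath 0 k)) 1)|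
        ≤ C * (1 / (((n - k : ℕ) : ℝ) + 1)) + C * (1 / ((k : ℝ) + 1)) := by
      intro k hk
      have hk' := Finset.mem_range.mp hk
      refine (abs_add_le _ _).trans (add_le_add
        (hh.abs_word_le (hA.isFareyWord_tail hk'.le) ?_)
        (hh.abs_word_le (hA.isFareyWord k).rev ?_))
      · rw [(mul_apply_entries _ _).2.1, (fareyPath_zero_entries n).2,
          Matrix.SpecialLinearGroup.SL2_inv_expl]
        simp [(fareyPath_zero_entries k).2]
      · rw [(wordRev_apply _).2.1, (fareyPath_zero_entries k).2]
    refine (Finset.sum_le_sum key).trans ?_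
    rw [Finset.sum_add_distrib, ← Finset.mul_sum, ← Finset.mul_sum]
    have := mul_le_mul_of_nonneg_left (harmonicSum_reflect n) hh.nonneg
    rw [harmonicSum] at this ⊢
    linarith
  exact ((continuous_coe_real_ereal.tendsto 0).comp h0).limsup_eq

/-! ### From cycle integrals to tree sums -/

theorem eventually_isHyperbolic_fareyPath {x : ℝ} (hx : 0 < x) :
    ∀ᶠ n in Filter.atTop, (fareyPath x n : Matrix (Fin 2) (Fin 2) ℤ).IsHyperbolic := by
  have hA := isWordPath_fareyPath x
  have hbd := fun n => (hA.isFareyWord n).bounds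
  have hstep : ∀ n, fareyPath x n 0 1 ≤ fareyPath x (n + 1) 0 1 ∧
      fareyPath x n 1 0 ≤ fareyPath x (n + 1) 1 0 := by
    intro n
    obtain ⟨-, v2, v3, -⟩ := mul_matV_apply (fareyPath x n)
    obtain ⟨-, t2, t3, -⟩ := mul_matT_apply (fareyPath x n)
    obtain ⟨h1, h2, h3, h4, -⟩ := hbd n
    rcases hA.2 n with h | h <;> rw [h]
    · rw [v2, v3]; constructor <;> linarith
    · rw [t2, t3]; constructor <;> linarith
  have hmono1 : Monotone fun n => fareyPath x n 0 1 := monotone_nat_of_le_succ fun n => (hstep n).1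
  have hmono2 : Monotone fun n => fareyPath x n 1 0 := monotone_nat_of_le_succ fun n => (hstep n).2
  obtain ⟨N, -, hN⟩ := (Filter.frequently_atTop.mp (isFareyPath_fareyPath hx).frequently) 0
  -- The off-diagonal entries never decrease. The upper right one becomes positive with the first
  -- `T`, the lower left one with a `V`; then `tr² - 4 = (a - d)² + 4 b c > 0`.
  have hM : ∃ M, fareyPath x (M + 1) = fareyPath x M * matT := by
    by_contra! hno
    have hV := fun n => (hA.2 n).resolve_right (hno n)
    have hgap : ∀ n : ℕ, upperGap x (fareyPath x n) = 1 - n * x ∧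
        lowerGap x (fareyPath x n) = x := by
      intro n
      induction n with
      | zero => simp [fareyPath, upperGap, lowerGap]
      | succ n ih =>
        rw [hV, (gaps_matV x _).1, (gaps_matV x _).2, ih.1, ih.2]
        push_cast
        exact ⟨by ring, rfl⟩
    obtain ⟨n, hn⟩ := exists_nat_gt (1 / x)
    rw [div_lt_iff₀ hx] at hn
    exact hno n ((fareyPath_succ_eq x n).2 (by rw [(hgap n).1, (hgap n).2]; linarith))
  obtain ⟨M, hM⟩ := hM
  filter_upwards [Filter.eventually_ge_atTop (max (M + 1) (N + 1))] with n hn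
  have hb : 1 ≤ fareyPath x n 0 1 := by
    refine le_trans ?_ (hmono1 ((le_max_left _ _).trans hn))
    obtain ⟨h1, h2, -⟩ := hbd M
    change 1 ≤ fareyPath x (M + 1) 0 1
    rw [hM, (mul_matT_apply _).2.1]; linarith
  have hc : 1 ≤ fareyPath x n 1 0 := by
    refine le_trans ?_ (hmono2 ((le_max_right _ _).trans hn))
    obtain ⟨-, -, h3, h4, -⟩ := hbd N
    change 1 ≤ fareyPath x (N + 1) 1 0
    rw [hN, (mul_matV_apply _).2.2.1]; linarith
  obtain ⟨h1, h2, h3, h4, -⟩ := hbd n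
  have hdet := det_eq_one (fareyPath x n)
  change 0 < Matrix.discr _
  rw [Matrix.discr_fin_two, Matrix.trace_fin_two, Matrix.det_fin_two]
  nlinarith [sq_nonneg (fareyPath x n 0 0 - fareyPath x n 1 1), mul_pos (lt_of_lt_of_le one_pos hb) (lt_of_lt_of_le one_pos hc)]

theorem lyapunovExponent_eq_treeExponent {f : ℍ → ℂ}
    (hf : IsWeaklyHolomorphicModularFunction f)
    (hreal : ∀ t ∈ arcAngles, (f (arcPoint t)).im = 0) {x : ℝ} (hx : 0 < x) :
    lyapunovExponent f x = treeExponent (arcWeight f) (fareyPath x) := by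
  have hC := isTreeWeight_arcWeight hf
  set C := (∫ t in (Real.pi / 3)..(2 * Real.pi / 3), |arcDensity f t|) * 16
  apply limsup_coe_congr_of_tendsto_sub
  have hlim : Filter.Tendsto (fun n : ℕ => 2 * C * (harmonicSum n / n)) Filter.atTop (𝓝 0) := by
    simpa using tendsto_harmonicSum_div.const_mul (2 * C)
  refine squeeze_zero_norm' ?_ hlim
  filter_upwards [eventually_isHyperbolic_fareyPath hx] with n hn
  rw [← sub_div, Real.norm_eq_abs, abs_div, Nat.abs_cast, ← mul_div_assoc]
  exact div_le_div_of_nonneg_right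
    (abs_re_cycleIntegral_sub_treeSum_le hf hreal hC (isWordPath_fareyPath x) hn)
    (Nat.cast_nonneg n)

/-! ### Invariance under `GL(2, ℤ)` -/

section Invariance

variable {h : ℝ → ℝ} {C : ℝ}

theorem treeExponent_add_one (hh : IsTreeWeight h C) {x : ℝ} (hx : 0 ≤ x) :
    treeExponent h (fareyPath (x + 1)) = treeExponent h (fareyPath x) :=
  treeExponent_cons hh (isWordPath_fareyPath x) (isWordPath_fareyPath _) isFareyWord_matT
    (fareyPath_add_one hx)

theorem treeExponent_div_one_add (hh : IsTreeWeight h C) {x : ℝ} (hx : 0 ≤ x) :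
    treeExponent h (fareyPath (x / (1 + x))) = treeExponent h (fareyPath x) :=
  treeExponent_cons hh (isWordPath_fareyPath x) (isWordPath_fareyPath _) isFareyWord_matV
    (fareyPath_div_one_add hx)

/-- The subtractive Euclidean algorithm: `T` and `V` undo the subtraction of the smaller of `a`, `b`
from the larger, until `0 / b` is reached. -/
theorem treeExponent_nat_div (hh : IsTreeWeight h C) (a b : ℕ) (hb : 0 < b) :
    treeExponent h (fareyPath ((a : ℝ) / b)) = 0 := by
  induction hs : a + b using Nat.strong_induction_on generalizing a b with
  | _ s ih =>
    have hbR : (0 : ℝ) < b := by exact_mod_cast hb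
    rcases Nat.eq_zero_or_pos a with rfl | ha
    · simpa using treeExponent_fareyPath_zero hh
    rcases le_or_gt b a with hba | hab
    · obtain ⟨c, rfl⟩ := Nat.exists_eq_add_of_le hba
      have e : ((b + c : ℕ) : ℝ) / b = (c : ℝ) / b + 1 := by
        push_cast; field_simp; ring
      rw [e, treeExponent_add_one hh (by positivity)]
      exact ih (c + b) (by omega) c b hb rfl
    · obtain ⟨c, rfl⟩ := Nat.exists_eq_add_of_lt hab
      have hc : (0 : ℝ) < (c + 1 : ℕ) := by positivity
      have e : (a : ℝ) / (a + c + 1 : ℕ) = (a : ℝ) / (c + 1 : ℕ) / (1 + (a : ℝ) / (c + 1 : ℕ)) := by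
        push_cast; field_simp; ring
      rw [e, treeExponent_div_one_add hh (by positivity)]
      exact ih (a + (c + 1)) (by omega) a (c + 1) (by omega) rfl

theorem treeExponent_abs_rat (hh : IsTreeWeight h C) (q : ℚ) :
    treeExponent h (fareyPath |(q : ℝ)|) = 0 := by
  have e : |(q : ℝ)| = (q.num.natAbs : ℝ) / q.den := by
    rw [Rat.cast_def, abs_div, Nat.abs_cast, Nat.cast_natAbs, Int.cast_abs]
  rw [e]
  exact treeExponent_nat_div hh _ _ q.den_pos

/-- For rational `x` the two paths need not be flips of each other, but there both exponents vanish.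
-/
theorem treeExponent_inv (hh : IsTreeWeight h C) {x : ℝ} (hx : 0 < x) :
    treeExponent h (fareyPath x⁻¹) = treeExponent h (fareyPath x) := by
  by_cases hirr : Irrational x
  · simp only [treeExponent,
      (isWordPath_fareyPath x).treeSum_flip hh (fareyPath_inv hx hirr)]
  · obtain ⟨q, rfl⟩ := not_not.mp hirr
    have h1 := treeExponent_abs_rat hh q
    have h2 := treeExponent_abs_rat hh q⁻¹
    rw [Rat.cast_inv, abs_of_pos (inv_pos.mpr hx)] at h2
    rw [abs_of_pos hx] at h1
    rw [h1, h2]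

/-- With `y = 1 / x - 1`, the chain `1 - x = y / (1 + y)`, `y`, `y + 1 = 1 / x`, `x` uses only moves
already treated. -/
theorem treeExponent_one_sub (hh : IsTreeWeight h C) {x : ℝ} (hx : 0 < x) (hx1 : x < 1) :
    treeExponent h (fareyPath (1 - x)) = treeExponent h (fareyPath x) := by
  have hy : 0 < x⁻¹ - 1 := sub_pos.mpr ((one_lt_inv₀ hx).mpr hx1)
  have e : 1 - x = (x⁻¹ - 1) / (1 + (x⁻¹ - 1)) := by field_simp; ring
  rw [e, treeExponent_div_one_add hh hy.le, ← treeExponent_add_one hh hy.le, sub_add_cancel,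
    treeExponent_inv hh hx]

/-- The extension of the exponent to the projective line. -/
noncomputable def projExponent (h : ℝ → ℝ) (x : OnePoint ℝ) : ℝ :=
  x.elim 0 fun x => (treeExponent h (fareyPath |x|)).toReal

theorem projExponent_infty : projExponent h OnePoint.infty = 0 := rfl

theorem projExponent_coe (x : ℝ) :
    projExponent h x = (treeExponent h (fareyPath |x|)).toReal := rfl

theorem projExponent_rat (hh : IsTreeWeight h C) (q : ℚ) : projExponent h (q : ℝ) = 0 := by
  rw [projExponent_coe, treeExponent_abs_rat hh, EReal.toReal_zero]

theorem projExponent_zero (hh : IsTreeWeight h C) : projExponent h (0 : ℝ) = 0 := by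
  rw [projExponent_coe, abs_zero, treeExponent_fareyPath_zero hh, EReal.toReal_zero]

theorem projExponent_neg (x : ℝ) : projExponent h (-x : ℝ) = projExponent h x := by
  rw [projExponent_coe, projExponent_coe, abs_neg]

theorem projExponent_inv (hh : IsTreeWeight h C) (x : ℝ) :
    projExponent h (x⁻¹ : ℝ) = projExponent h x := by
  rcases eq_or_ne x 0 with rfl | hx
  · rw [inv_zero]
  · rw [projExponent_coe, projExponent_coe, abs_inv, treeExponent_inv hh (abs_pos.mpr hx)]

theorem projExponent_add_one (hh : IsTreeWeight h C) (x : ℝ) :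
    projExponent h (x + 1 : ℝ) = projExponent h x := by
  suffices e : treeExponent h (fareyPath |x + 1|) = treeExponent h (fareyPath |x|) by
    rw [projExponent_coe, projExponent_coe, e]
  rcases le_or_gt 0 x with h0 | h0
  · rw [abs_of_nonneg h0, abs_of_nonneg (by linarith), treeExponent_add_one hh h0]
  rcases le_or_gt x (-1) with h1 | h1
  · rw [abs_of_neg h0, abs_of_nonpos (by linarith), ← treeExponent_add_one hh (by linarith)]
    congr 2
    ring
  -- For `-1 < x < 0` the translation crosses `0` and becomes `|x| ↦ 1 - |x|` on absolute values.
  · rw [abs_of_neg h0, abs_of_pos (by linarith),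
      ← treeExponent_one_sub hh (x := -x) (by linarith) (by linarith)]
    congr 2
    ring

/-- Invariance of `projExponent h` under an integral matrix. -/
def FixesExponent (h : ℝ → ℝ) (g : GL (Fin 2) ℤ) : Prop :=
  ∀ x : OnePoint ℝ,
    projExponent h (Matrix.GeneralLinearGroup.map (Int.castRingHom ℝ) g • x) = projExponent h x

theorem FixesExponent.mul {g g' : GL (Fin 2) ℤ} (hg : FixesExponent h g)
    (hg' : FixesExponent h g') : FixesExponent h (g * g') := by
  intro x
  rw [map_mul, mul_smul, hg, hg']

theorem FixesExponent.inv {g : GL (Fin 2) ℤ} (hg : FixesExponent h g) :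
    FixesExponent h g⁻¹ := by
  intro x
  rw [← hg, ← mul_smul, ← map_mul, mul_inv_cancel, map_one, one_smul]

theorem fixesExponent_one : FixesExponent h 1 := by
  intro x
  rw [map_one, one_smul]

theorem fixesExponent_T (hh : IsTreeWeight h C) :
    FixesExponent h (ModularGroup.T : SL(2, ℤ)) := by
  intro x
  induction x using OnePoint.rec with
  | infty => simp [OnePoint.smul_infty_eq_ite]
  | coe x =>
    rw [← projExponent_add_one hh x]
    simp [OnePoint.smul_some_eq_ite]

theorem fixesExponent_S (hh : IsTreeWeight h C) :
    FixesExponent h (ModularGroup.S : SL(2, ℤ)) := by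
  intro x
  induction x using OnePoint.rec with
  | infty =>
    refine Eq.trans (congrArg _ ?_) (projExponent_zero hh)
    simp [OnePoint.smul_infty_eq_ite]
  | coe x =>
    rcases eq_or_ne x 0 with rfl | hx
    · rw [projExponent_zero hh]
      refine Eq.trans (congrArg _ ?_) (projExponent_infty (h := h))
      simp [OnePoint.smul_some_eq_ite]
    · rw [← projExponent_inv hh x, ← projExponent_neg]
      simp [OnePoint.smul_some_eq_ite, hx, neg_div]

/-- The reflection `x ↦ -x`. -/
def reflection : GL (Fin 2) ℤ :=
  ⟨!![-1, 0; 0, 1], !![-1, 0; 0, 1], by simp [Matrix.one_fin_two], by simp [Matrix.one_fin_two]⟩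

theorem fixesExponent_reflection : FixesExponent h reflection := by
  intro x
  induction x using OnePoint.rec with
  | infty => simp [OnePoint.smul_infty_eq_ite, reflection]
  | coe x =>
    rw [← projExponent_neg x]
    simp [OnePoint.smul_some_eq_ite, reflection]

theorem fixesExponent_specialLinearGroup (hh : IsTreeWeight h C) (γ : SL(2, ℤ)) :
    FixesExponent h γ := by
  have hγ : γ ∈ Subgroup.closure {ModularGroup.S, ModularGroup.T} := by
    rw [SpecialLinearGroup.SL2Z_generators]; trivial
  induction hγ using Subgroup.closure_induction with
  | mem γ hγ =>
    rcases hγ with rfl | rfl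
    exacts [fixesExponent_S hh, fixesExponent_T hh]
  | one => rw [map_one]; exact fixesExponent_one
  | mul _ _ _ _ h1 h2 => rw [map_mul]; exact h1.mul h2
  | inv _ _ h1 => rw [map_inv]; exact h1.inv

/-- A matrix of determinant `-1` becomes one of determinant `1` after multiplication by
`reflection`, so the generators `S` and `T` and the reflection suffice. -/
theorem fixesExponent (hh : IsTreeWeight h C) (g : GL (Fin 2) ℤ) : FixesExponent h g := by
  have key : ∀ g : GL (Fin 2) ℤ, (g : Matrix (Fin 2) (Fin 2) ℤ).det = 1 → FixesExponent h g := by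
    intro g hg
    have e : Matrix.SpecialLinearGroup.toGL (⟨g, hg⟩ : SL(2, ℤ)) = g := Units.ext rfl
    rw [← e]
    exact fixesExponent_specialLinearGroup hh _
  have hu : IsUnit (g : Matrix (Fin 2) (Fin 2) ℤ).det :=
    (Matrix.isUnit_iff_isUnit_det _).mp g.isUnit
  rcases Int.isUnit_iff.mp hu with h1 | h1
  · exact key g h1
  · have h2 : FixesExponent h (reflection * g) := key _ (by
      rw [Units.val_mul, Matrix.det_mul, h1]
      simp [reflection, Matrix.det_fin_two])
    have := (fixesExponent_reflection (h := h)).inv.mul h2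
    rwa [inv_mul_cancel_left] at this

end Invariance

end FareyLyapunov

theorem theorem1p1 (f : ℍ → ℂ)
    (hf : FareyLyapunov.IsWeaklyHolomorphicModularFunction f) (hf0 : f ≠ 0)
    (harc : ∀ t ∈ Set.Icc (Real.pi / 3) (2 * Real.pi / 3), ∀ τ : ℍ,
      (τ : ℂ) = Complex.exp (t * Complex.I) → (f τ).im = 0 ∧ 0 ≤ (f τ).re) :
    (∀ x : ℝ, 0 < x →
      FareyLyapunov.lyapunovExponent f x ≠ ⊥ ∧ FareyLyapunov.lyapunovExponent f x ≠ ⊤) ∧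
    ∃ Λ : OnePoint ℝ → ℝ,
      (∀ x : ℝ, 0 < x → (Λ (x : OnePoint ℝ) : EReal) = FareyLyapunov.lyapunovExponent f x) ∧
      (∀ (g : GL (Fin 2) ℤ) (x : OnePoint ℝ),
        Λ (Matrix.GeneralLinearGroup.map (Int.castRingHom ℝ) g • x) = Λ x) ∧
      (∀ x : OnePoint ℚ, Λ (x.map (fun q : ℚ => (q : ℝ))) = 0) := by
  have hreal : ∀ t ∈ FareyLyapunov.arcAngles, (f (FareyLyapunov.arcPoint t)).im = 0 :=
    fun t ht => (harc t ht _ (FareyLyapunov.coe_arcPoint (FareyLyapunov.mem_arc_bounds ht).1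
      (FareyLyapunov.mem_arc_bounds ht).2)).1
  have hh := FareyLyapunov.isTreeWeight_arcWeight hf
  have hne := fun x => FareyLyapunov.treeExponent_ne hh (FareyLyapunov.isWordPath_fareyPath x)
  have heq := fun x => FareyLyapunov.lyapunovExponent_eq_treeExponent hf hreal (x := x)
  refine ⟨fun x hx => heq x hx ▸ hne x,
    FareyLyapunov.projExponent (FareyLyapunov.arcWeight f), fun x hx => ?_,
    FareyLyapunov.fixesExponent hh, fun x => ?_⟩
  · rw [FareyLyapunov.projExponent_coe, abs_of_pos hx, heq x hx,
      EReal.coe_toReal (hne x).2 (hne x).1]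
  · induction x using OnePoint.rec with
    | infty => rfl
    | coe q => exact FareyLyapunov.projExponent_rat hh q
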